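/- Let $(\Omega,\mathcal F,\mathbb P)$ be a probability space, let $\sigma_1,\sigma_2>0$ and $\rho\in(-1,1)$ be constants, let $B_1$ and $B_3$ be independent standard Brownian motions on $[0,1]$, and put $B_2=\rho B_1+\sqrt{1-\rho^2}\,B_3$. For $\ell=1,2$ let $b_\ell\in L^\infty([0,1]\times\Omega,dt\otimes\mathbb P)$ and let $X_\ell=(X_{\ell,t})_{t\in[0,1]}$ be a process with $dX_{\ell,t}=\sigma_\ell\,dB_{\ell,t}+b_\ell(t,\omega)\,dt$, that is, almost surely $X_{\ell,t}=X_{\ell,0}+\sigma_\ell B_{\ell,t}+\int_0^t b_\ell(s,\omega)\,ds$ for all $t\in[0,1]$. With $\Delta_k^nX_\ell=X_{\ell,k/n}-X_{\ell,(k-1)/n}$ let $$V_1^n(X)=\Big(\sum_{k=1}^n(\Delta_k^nX_1)^2,\ \sum_{k=1}^n(\Delta_k^nX_2)^2,\ \sum_{k=1}^n\Delta_k^nX_1\,\Delta_k^nX_2\Big).$$ For $-1<c<1$ and $x=(x_1,x_2,x_3)\in\mathbb R^3$ let $$P^*_c(x)=\log\frac{\sqrt{1-c^2}}{\sqrt{x_1x_2-x_3^2}}-1+\frac{x_1+x_2-2cx_3}{2(1-c^2)}\quad\text{if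 }x_1>0,\ x_2>0,\ x_1x_2>x_3^2,$$ and $P^*_c(x)=+\infty$ otherwise. Then $V_1^n(X)$ satisfies the large deviation principle on $\mathbb R^3$ with speed $n$ and with the good rate function $$I(x)=P^*_\rho\Big(\frac{x_1}{\sigma_1^2},\frac{x_2}{\sigma_2^2},\frac{x_3}{\sigma_1\sigma_2}\Big).$$ That is, $I:\mathbb R^3\to[0,+\infty]$ is lower semicontinuous with compact sub-level sets $\{I\le a\}$, $a\ge0$, and for every Borel set $A\subseteq\mathbb R^3$ $$-\inf_{x\in A^{\circ}}I(x)\le\liminf_{n\to\infty}\frac1n\log\mathbb P(V_1^n(X)\in A)\le\limsup_{n\to\infty}\frac1n\log\mathbb P(V_1^n(X)\in A)\le-\inf_{x\in\bar A}I(x).$$ -/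

import Mathlib

open MeasureTheory ProbabilityTheory Filter Topology

/-- A (real, standard) Brownian motion on the time interval `[0, 1]`. Only the values `B t` with
`t ∈ [0, 1]` matter. -/
structure IsBrownianUnit {Ω : Type*} [MeasurableSpace Ω] (B : ℝ → Ω → ℝ) (P : Measure Ω) :
    Prop where
  start_zero : ∀ᵐ ω ∂P, B 0 ω = 0
  indep_increments : HasIndepIncrements (fun (t : Set.Icc (0 : ℝ) 1) ω => B t ω) P
  gaussian_increments : ∀ s t : ℝ, 0 ≤ s → s ≤ t → t ≤ 1 →
    HasLaw (fun ω => B t ω - B s ω) (gaussianReal 0 (Real.toNNReal (t - s))) P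
  continuous_paths : ∀ᵐ ω ∂P, ContinuousOn (fun t => B t ω) (Set.Icc 0 1)

/-- Independence of two processes on `[0, 1]` (as random elements of `ℝ^[0,1]`). -/
def IndepProcessesUnit {Ω : Type*} [MeasurableSpace Ω] (B B' : ℝ → Ω → ℝ) (P : Measure Ω) :
    Prop :=
  IndepFun (fun ω (t : Set.Icc (0 : ℝ) 1) => B t ω) (fun ω (t : Set.Icc (0 : ℝ) 1) => B' t ω) P

/-- The process `B₂ = ρ B₁ + √(1 - ρ²) B₃`, for a constant `ρ`. -/
noncomputable def correlatedProcess {Ω : Type*} (ρ : ℝ) (B₁ B₃ : ℝ → Ω → ℝ) : ℝ → Ω → ℝ :=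
  fun t ω => ρ * B₁ t ω + Real.sqrt (1 - ρ ^ 2) * B₃ t ω

/-- Essentially bounded drift: `b ∈ L^∞([0, 1] × Ω, dt ⊗ P)`. -/
def BoundedDrift {Ω : Type*} [MeasurableSpace Ω] (b : ℝ → Ω → ℝ) (P : Measure Ω) : Prop :=
  MemLp (Function.uncurry b) ⊤ ((volume.restrict (Set.Icc (0 : ℝ) 1)).prod P)

/-- `dX_t = σ dB_t + b(t, ω) dt` on `[0, 1]` with a constant diffusion coefficient `σ`, in its
integrated form `X_t = X_0 + σ B_t + ∫_0^t b(s, ω) ds` (the stochastic integral of the constant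
`σ` against `B` is `σ (B_t - B_0)`, with `B_0 = 0`). -/
def SolvesIto {Ω : Type*} [MeasurableSpace Ω] (σ : ℝ) (B b X : ℝ → Ω → ℝ) (P : Measure Ω) :
    Prop :=
  ∀ᵐ ω ∂P, ∀ t ∈ Set.Icc (0 : ℝ) 1, X t ω = X 0 ω + σ * B t ω + ∫ s in (0 : ℝ)..t, b s ω

/-- The increment `Δ_k^n Z = Z_{k/n} - Z_{(k-1)/n}`. -/
noncomputable def increment {Ω : Type*} (n k : ℕ) (Z : ℝ → Ω → ℝ) (ω : Ω) : ℝ :=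
  Z ((k : ℝ) / n) ω - Z (((k : ℝ) - 1) / n) ω

/-- Realized covariance `C_t^n = ∑_{k=1}^{[nt]} (Δ_k^n Z) (Δ_k^n Z')`. -/
noncomputable def realizedCovariance {Ω : Type*} (n : ℕ) (t : ℝ) (Z Z' : ℝ → Ω → ℝ) (ω : Ω) : ℝ :=
  ∑ k ∈ Finset.Icc 1 ⌊(n : ℝ) * t⌋₊, increment n k Z ω * increment n k Z' ω

/-- Realized volatility `Q_t^n = ∑_{k=1}^{[nt]} (Δ_k^n Z)²`. -/
noncomputable def realizedVolatility {Ω : Type*} (n : ℕ) (t : ℝ) (Z : ℝ → Ω → ℝ) (ω : Ω) : ℝ :=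
  ∑ k ∈ Finset.Icc 1 ⌊(n : ℝ) * t⌋₊, increment n k Z ω ^ 2

/-- The vector `V_t^n(X) = (Q_{1,t}^n(X), Q_{2,t}^n(X), C_t^n(X))`. -/
noncomputable def realizedVector {Ω : Type*} (n : ℕ) (t : ℝ) (X₁ X₂ : ℝ → Ω → ℝ) (ω : Ω) :
    Fin 3 → ℝ :=
  ![realizedVolatility n t X₁ ω, realizedVolatility n t X₂ ω, realizedCovariance n t X₁ X₂ ω]

/-- A good rate function: `[0, ∞]`-valued, lower semicontinuous, with compact sub-level sets. -/
structure IsGoodRateFunction {S : Type*} [TopologicalSpace S] (I : S → EReal) : Prop where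
  nonneg : ∀ x, 0 ≤ I x
  lowerSemicontinuous : LowerSemicontinuous I
  isCompact_sublevel : ∀ c : ℝ, 0 ≤ c → IsCompact {x | I x ≤ (c : EReal)}

/-- The random variables `M n` satisfy the large deviation principle with the given speed and
good rate function `I`. Here `ENNReal.log 0 = ⊥`, and the infimum over the empty set is `⊤`. -/
structure SatisfiesGoodLDP {Ω S : Type*} [MeasurableSpace Ω] [TopologicalSpace S]
    [MeasurableSpace S] (P : Measure Ω) (M : ℕ → Ω → S) (speed : ℕ → ℝ) (I : S → EReal) :
    Prop where
  speed_nonneg : ∀ n, 0 ≤ speed n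
  speed_tendsto : Tendsto speed atTop atTop
  aemeasurable : ∀ n, AEMeasurable (M n) P
  good : IsGoodRateFunction I
  lower_bound : ∀ A : Set S, MeasurableSet A →
    -(⨅ x ∈ interior A, I x) ≤
      liminf (fun n => (((speed n)⁻¹ : ℝ) : EReal) * ENNReal.log (P {ω | M n ω ∈ A})) atTop
  upper_bound : ∀ A : Set S, MeasurableSet A →
    limsup (fun n => (((speed n)⁻¹ : ℝ) : EReal) * ENNReal.log (P {ω | M n ω ∈ A})) atTop ≤
      -(⨅ x ∈ closure A, I x)

open scoped Classical in
/-- The function `P*_c`. -/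
noncomputable def Pstar (c : ℝ) (x : Fin 3 → ℝ) : EReal :=
  if 0 < x 0 ∧ 0 < x 1 ∧ x 2 ^ 2 < x 0 * x 1 then
    ((Real.log (Real.sqrt (1 - c ^ 2) / Real.sqrt (x 0 * x 1 - x 2 ^ 2)) - 1
      + (x 0 + x 1 - 2 * c * x 2) / (2 * (1 - c ^ 2)) : ℝ) : EReal)
  else ⊤

/-! Without drift, the normalized increments of `(B₁, B₃)` form `n` independent standard Gaussian
pairs, and the realized vector is the empirical mean of their vectors `(a², b², ab)`. The large
deviations of this mean come from a Gaussian change of covariance rather than from a general Cramér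
theorem. Relative to the centred Gaussian law with covariance `S`, the standard law has density `exp
(-g_s)`, where `g_s` (`gaussianLogRatio s`) is affine in the quadratic vector. Over `n` pairs the
density is therefore `exp (-n g_s)` evaluated at the empirical mean (`pi_stdGaussianPair_eq`).

Bounding `g_s` below on a set gives an exponential upper bound there (`pi_stdGaussianPair_le`).
Bounding it above near `s` gives a lower bound, because the tilted means concentrate at `s` by the
law of large numbers (`eventually_le_pi_stdGaussianPair`). The two match since `g_s(s)` is the value
of `Pstar 0` at every positive definite `s`.

An invertible linear map of quadratic vectors carries this case to volatilities `σ₁, σ₂` and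
correlation `ρ`, and `Pstar_scaled_eq` transports the rate function. The drift moves each increment
by `O(1/n)`, hence the realized vector by `O(1/√n)` as long as the Brownian realized variances stay
bounded. Exceeding a large bound costs an arbitrarily large exponential rate, so the two vectors are
exponentially equivalent and `LocalLDP.of_exponentially_close` applies. -/

/-! ### Local large deviation bounds and passage to the full principle -/

theorem eventually_const_mul_exp_le {C : ENNReal} (hC : C ≠ ⊤) {c c' : ℝ} (h : c < c') :
    ∀ᶠ n : ℕ in atTop, C * ENNReal.ofReal (Real.exp (-(n * c'))) ≤
      ENNReal.ofReal (Real.exp (-(n * c))) := by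
  have ht : Tendsto (fun n : ℕ => Real.exp (n * (c' - c))) atTop atTop :=
    Real.tendsto_exp_atTop.comp
      (tendsto_natCast_atTop_atTop.atTop_mul_const (sub_pos.2 h))
  filter_upwards [ht.eventually_ge_atTop C.toReal] with n hn
  rw [← ENNReal.ofReal_toReal hC, ← ENNReal.ofReal_mul ENNReal.toReal_nonneg]
  apply ENNReal.ofReal_le_ofReal
  calc C.toReal * Real.exp (-(n * c'))
      ≤ Real.exp (n * (c' - c)) * Real.exp (-(n * c')) := by gcongr
    _ = Real.exp (-(n * c)) := by rw [← Real.exp_add]; ring_nf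

theorem eventually_add_exp_le {c c' : ℝ} (h : c < c') :
    ∀ᶠ n : ℕ in atTop, ENNReal.ofReal (Real.exp (-(n * c'))) + ENNReal.ofReal (Real.exp (-(n * c')))
      ≤ ENNReal.ofReal (Real.exp (-(n * c))) := by
  filter_upwards [eventually_const_mul_exp_le (C := 2) (by simp) h] with n hn
  rwa [← two_mul]

/-- Local form of the large deviation bounds with speed `n`, together with exponential
tightness. -/
structure LocalLDP {Ω S : Type*} [MeasurableSpace Ω] [TopologicalSpace S] (P : Measure Ω)
    (M : ℕ → Ω → S) (I : S → EReal) : Prop where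
  upper : ∀ (x : S) (c : ℝ), (c : EReal) < I x → ∃ U ∈ 𝓝 x, ∀ᶠ n : ℕ in atTop,
    P {ω | M n ω ∈ U} ≤ ENNReal.ofReal (Real.exp (-(n * c)))
  lower : ∀ (x : S) (c : ℝ), I x < (c : EReal) → ∀ U ∈ 𝓝 x, ∀ᶠ n : ℕ in atTop,
    ENNReal.ofReal (Real.exp (-(n * c))) ≤ P {ω | M n ω ∈ U}
  tight : ∀ c : ℝ, ∃ K : Set S, IsCompact K ∧ ∀ᶠ n : ℕ in atTop,
    P {ω | M n ω ∉ K} ≤ ENNReal.ofReal (Real.exp (-(n * c)))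

namespace LocalLDP

variable {Ω S S' : Type*} [MeasurableSpace Ω] {P : Measure Ω}

theorem comp_homeomorph [TopologicalSpace S] [TopologicalSpace S'] {M : ℕ → Ω → S}
    {I : S → EReal} (h : LocalLDP P M I) (e : S ≃ₜ S') :
    LocalLDP P (fun n ω => e (M n ω)) (fun y => I (e.symm y)) where
  upper y c hc := by
    obtain ⟨U, hU, h'⟩ := h.upper _ c hc
    refine ⟨e.symm ⁻¹' U, e.symm.continuous.continuousAt.preimage_mem_nhds hU, ?_⟩
    simpa using h'
  lower y c hc U hU :=
    h.lower _ c hc (e ⁻¹' U) (e.continuous.continuousAt.preimage_mem_nhds (by simpa using hU))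
  tight c := by
    obtain ⟨K, hK, h'⟩ := h.tight c
    refine ⟨e.symm ⁻¹' K, e.symm.isCompact_preimage.2 hK, ?_⟩
    simpa using h'

/-- Replacing `M` by `M'` costs half a radius and an event negligible at every exponential rate.
Properness keeps a thickened compact set compact, which preserves tightness. -/
theorem of_exponentially_close [PseudoMetricSpace S] [ProperSpace S] {M M' : ℕ → Ω → S}
    {I : S → EReal} (h : LocalLDP P M I)
    (hd : ∀ δ : ℝ, 0 < δ → ∀ c : ℝ, ∀ᶠ n : ℕ in atTop,
      P {ω | δ ≤ dist (M n ω) (M' n ω)} ≤ ENNReal.ofReal (Real.exp (-(n * c)))) :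
    LocalLDP P M' I where
  upper x c hc := by
    obtain ⟨c', hcc', hc'⟩ := EReal.lt_iff_exists_real_btwn.1 hc
    obtain ⟨U, hU, h'⟩ := h.upper _ c' hc'
    obtain ⟨r, hr, hrU⟩ := Metric.mem_nhds_iff.1 hU
    refine ⟨Metric.ball x (r / 2), Metric.ball_mem_nhds _ (by positivity), ?_⟩
    filter_upwards [h', hd (r / 2) (by positivity) c',
      eventually_add_exp_le (EReal.coe_lt_coe_iff.1 hcc')] with n h1 h2 h3
    refine le_trans ?_ ((add_le_add h1 h2).trans h3)
    refine (measure_mono fun ω hω => ?_).trans (measure_union_le _ _)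
    by_cases hdist : r / 2 ≤ dist (M n ω) (M' n ω)
    · exact Or.inr hdist
    · refine Or.inl (hrU ?_)
      have h4 : dist (M' n ω) x < r / 2 := hω
      have := dist_triangle (M n ω) (M' n ω) x
      rw [Metric.mem_ball]
      linarith
  lower x c hc U hU := by
    obtain ⟨c', hc', hcc'⟩ := EReal.lt_iff_exists_real_btwn.1 hc
    obtain ⟨r, hr, hrU⟩ := Metric.mem_nhds_iff.1 hU
    filter_upwards [h.lower x c' hc' (Metric.ball x (r / 2))
      (Metric.ball_mem_nhds _ (by positivity)), hd (r / 2) (by positivity) c,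
      eventually_add_exp_le (EReal.coe_lt_coe_iff.1 hcc')] with n h1 h2 h3
    · have h4 : P {ω | M n ω ∈ Metric.ball x (r / 2)} ≤
          P {ω | M' n ω ∈ U} + P {ω | r / 2 ≤ dist (M n ω) (M' n ω)} := by
        refine (measure_mono fun ω hω => ?_).trans (measure_union_le _ _)
        by_cases hdist : r / 2 ≤ dist (M n ω) (M' n ω)
        · exact Or.inr hdist
        · refine Or.inl (hrU ?_)
          have h4 : dist (M n ω) x < r / 2 := hω
          have := dist_triangle (M' n ω) (M n ω) x
          rw [dist_comm] at hdist
          rw [Metric.mem_ball]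
          linarith
      -- The lower bound for `M` is at least twice `exp (-n c)`; one copy pays for the event where
      -- the two are far apart and is cancelled.
      exact ENNReal.le_of_add_le_add_right ENNReal.ofReal_ne_top
        (((h3.trans h1).trans h4).trans (add_le_add le_rfl h2))
  tight c := by
    obtain ⟨K, hK, h'⟩ := h.tight (c + 1)
    refine ⟨Metric.cthickening 1 K, hK.cthickening, ?_⟩
    filter_upwards [h', hd 1 one_pos (c + 1), eventually_add_exp_le (lt_add_one c)] with n h1 h2 h3
    refine le_trans ?_ ((add_le_add h1 h2).trans h3)
    refine (measure_mono fun ω hω => ?_).trans (measure_union_le _ _)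
    by_cases hdist : 1 ≤ dist (M n ω) (M' n ω)
    · exact Or.inr hdist
    · refine Or.inl fun hK' => hω ?_
      refine Metric.mem_cthickening_of_dist_le _ _ _ _ hK' ?_
      rw [dist_comm]
      linarith

/-- Tightness reduces to a compact piece of `F`, which finitely many local neighbourhoods cover. The
gap between `c` and `c'` absorbs their number. -/
theorem eventually_measure_le_of_isClosed [TopologicalSpace S] {M : ℕ → Ω → S}
    {I : S → EReal} (h : LocalLDP P M I) {F : Set S} (hF : IsClosed F) {c : ℝ}
    (hc : (c : EReal) < ⨅ x ∈ F, I x) :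
    ∀ᶠ n : ℕ in atTop, P {ω | M n ω ∈ F} ≤ ENNReal.ofReal (Real.exp (-(n * c))) := by
  obtain ⟨c', hcc', hc'⟩ := EReal.lt_iff_exists_real_btwn.1 hc
  obtain ⟨K, hK, hKt⟩ := h.tight c'
  have key : ∃ N : ℕ, ∀ᶠ n : ℕ in atTop, P {ω | M n ω ∈ K ∩ F} ≤
      N * ENNReal.ofReal (Real.exp (-(n * c'))) := by
    -- The multiplicity `N` may depend on the set, so the property survives unions and compact
    -- induction replaces an explicit finite subcover.
    refine (hK.inter_right hF).induction_on
      (p := fun s => ∃ N : ℕ, ∀ᶠ n : ℕ in atTop, P {ω | M n ω ∈ s} ≤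
        N * ENNReal.ofReal (Real.exp (-(n * c')))) ⟨0, by simp⟩ ?_ ?_ ?_
    · rintro s t hst ⟨N, hN⟩
      exact ⟨N, hN.mono fun n hn => le_trans (measure_mono fun ω hω => hst hω) hn⟩
    · rintro s t ⟨N, hN⟩ ⟨N', hN'⟩
      refine ⟨N + N', ?_⟩
      filter_upwards [hN, hN'] with n h1 h2
      push_cast
      rw [add_mul]
      exact (measure_union_le _ _).trans (add_le_add h1 h2)
    · intro x hx
      obtain ⟨U, hU, hU'⟩ := h.upper x c' (hc'.trans_le (iInf₂_le x hx.2))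
      exact ⟨U, mem_nhdsWithin_of_mem_nhds hU, 1, by simpa using hU'⟩
  obtain ⟨N, hN⟩ := key
  filter_upwards [hN, hKt, eventually_const_mul_exp_le (C := (N + 1 : ℕ))
    (ENNReal.natCast_ne_top _) (EReal.coe_lt_coe_iff.1 hcc')] with n h1 h2 h3
  refine le_trans ?_ h3
  push_cast
  rw [add_mul, one_mul]
  refine le_trans ?_ (add_le_add h1 h2)
  refine (measure_mono fun ω hω => ?_).trans (measure_union_le _ _)
  by_cases hKω : M n ω ∈ K
  · exact Or.inl ⟨hKω, hω⟩
  · exact Or.inr hKω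

theorem inv_mul_log_exp {n : ℕ} (hn : 0 < n) (c : ℝ) :
    ((((n : ℝ))⁻¹ : ℝ) : EReal) * ENNReal.log (ENNReal.ofReal (Real.exp (-(n * c)))) =
      ((-c : ℝ) : EReal) := by
  rw [ENNReal.log_ofReal_of_pos (Real.exp_pos _), Real.log_exp, ← EReal.coe_mul]
  congr 1
  field_simp

theorem satisfiesGoodLDP [TopologicalSpace S] [MeasurableSpace S] {M : ℕ → Ω → S}
    {I : S → EReal} (h : LocalLDP P M I) (hI : IsGoodRateFunction I)
    (hM : ∀ n, AEMeasurable (M n) P) :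
    SatisfiesGoodLDP P M (fun n => (n : ℝ)) I where
  speed_nonneg n := n.cast_nonneg
  speed_tendsto := tendsto_natCast_atTop_atTop
  aemeasurable := hM
  good := hI
  lower_bound A _ := by
    rw [EReal.neg_le]
    refine le_iInf₂ fun x hx => EReal.le_of_forall_lt_iff_le.1 fun c hc => ?_
    rw [EReal.neg_le]
    refine le_liminf_of_le (by isBoundedDefault) ?_
    filter_upwards [h.lower x c hc A (mem_interior_iff_mem_nhds.1 hx), eventually_gt_atTop 0]
      with n h1 hn
    rw [← EReal.coe_neg, ← inv_mul_log_exp hn c]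
    exact mul_le_mul_of_nonneg_left (ENNReal.log_le_log h1) (by positivity)
  upper_bound A _ := by
    rw [EReal.le_neg]
    refine EReal.ge_of_forall_gt_iff_ge.1 fun c hc => ?_
    rw [EReal.le_neg]
    refine limsup_le_of_le (by isBoundedDefault) ?_
    filter_upwards [h.eventually_measure_le_of_isClosed isClosed_closure hc,
      eventually_gt_atTop 0] with n h1 hn
    rw [← EReal.coe_neg, ← inv_mul_log_exp hn c]
    refine mul_le_mul_of_nonneg_left (ENNReal.log_le_log (le_trans ?_ h1)) (by positivity)
    exact measure_mono fun ω hω => subset_closure hω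

end LocalLDP

/-! ### Gaussian change of measure -/

/-- The law of a pair of independent standard Gaussian variables. -/
noncomputable def stdGaussianPair : Measure (ℝ × ℝ) :=
  (gaussianReal 0 1).prod (gaussianReal 0 1)

instance : IsProbabilityMeasure stdGaussianPair := by
  unfold stdGaussianPair; infer_instance

/-- The vector `(a², b², ab)` of a pair `(a, b)`. -/
def quadraticVector (z : ℝ × ℝ) : Fin 3 → ℝ := ![z.1 ^ 2, z.2 ^ 2, z.1 * z.2]

/-- The determinant of the symmetric matrix with diagonal `s 0, s 1` and off-diagonal `s 2`. -/
def symDet (s : Fin 3 → ℝ) : ℝ := s 0 * s 1 - s 2 ^ 2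

/-- `tr (S⁻¹ Y)`, where `S` and `Y` are the symmetric matrices with entries `s` and `y`. -/
noncomputable def traceInvMul (s y : Fin 3 → ℝ) : ℝ :=
  (y 0 * s 1 + y 1 * s 0 - 2 * y 2 * s 2) / symDet s

/-- The logarithmic density of a Gaussian law with covariance `S` relative to the standard one, as
a function of the quadratic vector. -/
noncomputable def gaussianLogRatio (s y : Fin 3 → ℝ) : ℝ :=
  (y 0 + y 1 - traceInvMul s y - Real.log (symDet s)) / 2

/-- The empirical mean of the quadratic vectors. -/
noncomputable def empiricalQuadratic (n : ℕ) (z : Fin n → ℝ × ℝ) : Fin 3 → ℝ :=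
  (n : ℝ)⁻¹ • ∑ i, quadraticVector (z i)

@[fun_prop]
theorem continuous_quadraticVector : Continuous quadraticVector := by
  unfold quadraticVector
  refine continuous_pi fun i => ?_
  fin_cases i <;> simp <;> fun_prop

@[fun_prop]
theorem continuous_gaussianLogRatio (s : Fin 3 → ℝ) : Continuous (gaussianLogRatio s) := by
  unfold gaussianLogRatio traceInvMul
  fun_prop

@[fun_prop]
theorem measurable_empiricalQuadratic (n : ℕ) : Measurable (empiricalQuadratic n) := by
  unfold empiricalQuadratic
  have := continuous_quadraticVector.measurable
  fun_prop

theorem stdGaussianPair_eq_withDensity :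
    stdGaussianPair = (volume : Measure (ℝ × ℝ)).withDensity
      fun z => ENNReal.ofReal ((2 * Real.pi)⁻¹ * Real.exp (-(z.1 ^ 2 + z.2 ^ 2) / 2)) := by
  rw [stdGaussianPair, gaussianReal_of_var_ne_zero _ one_ne_zero,
    prod_withDensity (measurable_gaussianPDF _ _) (measurable_gaussianPDF _ _)]
  rw [← Measure.volume_eq_prod]
  congr 1
  ext z
  rw [gaussianPDF, gaussianPDF, ← ENNReal.ofReal_mul (gaussianPDFReal_nonneg _ _ _)]
  congr 1
  simp only [gaussianPDFReal, NNReal.coe_one, mul_one, sub_zero]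
  have h : (√(2 * Real.pi))⁻¹ * (√(2 * Real.pi))⁻¹ = (2 * Real.pi)⁻¹ := by
    rw [← mul_inv, Real.mul_self_sqrt (by positivity)]
  rw [mul_mul_mul_comm, h, ← Real.exp_add]
  ring_nf

/-- The image of `φ dx` under `f` has density `φ ∘ f⁻¹ / |det f|`; the hypothesis says that `g`
turns this back into `φ`. -/
theorem map_withDensity_comp_linear {f : (ℝ × ℝ) →ₗ[ℝ] (ℝ × ℝ)} (hf : LinearMap.det f ≠ 0)
    {φ g : ℝ × ℝ → ENNReal} (hφ : Measurable φ) (hg : Measurable g)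
    (h : ∀ w, g (f w) * φ w = ENNReal.ofReal |LinearMap.det f| * φ (f w)) :
    ((volume.withDensity φ).map f).withDensity g = volume.withDensity φ := by
  have hfm : Measurable f := f.continuous_of_finiteDimensional.measurable
  ext t ht
  rw [withDensity_apply _ ht, ← lintegral_indicator ht,
    lintegral_map (hg.indicator ht) hfm,
    lintegral_withDensity_eq_lintegral_mul _ hφ
      (g := fun a => t.indicator g (f a)) ((hg.indicator ht).comp hfm),
    withDensity_apply _ ht, ← lintegral_indicator ht]
  have h1 : ∀ w, (φ * fun a => t.indicator g (f a)) w =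
      ENNReal.ofReal |LinearMap.det f| * t.indicator φ (f w) := by
    intro w
    by_cases hw : f w ∈ t
    · simp [hw, ← h, mul_comm]
    · simp [hw]
  rw [lintegral_congr h1, lintegral_const_mul (f := fun w => t.indicator φ (f w)) _
      ((hφ.indicator ht).comp hfm),
    ← lintegral_map (hφ.indicator ht) hfm, Measure.map_linearMap_addHaar_eq_smul_addHaar _ hf,
    lintegral_smul_measure, smul_eq_mul, ← mul_assoc, ← ENNReal.ofReal_mul (abs_nonneg _),
    abs_inv, mul_inv_cancel₀ (abs_ne_zero.2 hf), ENNReal.ofReal_one, one_mul]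

theorem integrable_sq_gaussianReal : Integrable (fun x : ℝ => x ^ 2) (gaussianReal 0 1) :=
  (memLp_id_gaussianReal 2).integrable_sq

theorem integral_sq_gaussianReal : ∫ x, x ^ 2 ∂(gaussianReal 0 1) = 1 := by
  have h := variance_fun_id_gaussianReal (μ := 0) (v := 1)
  rw [variance_eq_integral (by fun_prop)] at h
  simpa using h

theorem integrable_fun_id_gaussianReal : Integrable (fun x : ℝ => x) (gaussianReal 0 1) :=
  (memLp_id_gaussianReal 1).integrable le_rfl

theorem hasIntegral_fst_sq : Integrable (fun z : ℝ × ℝ => z.1 ^ 2) stdGaussianPair ∧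
    ∫ z, z.1 ^ 2 ∂stdGaussianPair = 1 := by
  refine ⟨integrable_sq_gaussianReal.comp_fst _, ?_⟩
  rw [stdGaussianPair, integral_fun_fst (fun x : ℝ => x ^ 2), integral_sq_gaussianReal]
  simp

theorem hasIntegral_snd_sq : Integrable (fun z : ℝ × ℝ => z.2 ^ 2) stdGaussianPair ∧
    ∫ z, z.2 ^ 2 ∂stdGaussianPair = 1 := by
  refine ⟨integrable_sq_gaussianReal.comp_snd _, ?_⟩
  rw [stdGaussianPair, integral_fun_snd (fun x : ℝ => x ^ 2), integral_sq_gaussianReal]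
  simp

theorem hasIntegral_fst_mul_snd : Integrable (fun z : ℝ × ℝ => z.1 * z.2) stdGaussianPair ∧
    ∫ z, z.1 * z.2 ∂stdGaussianPair = 0 := by
  refine ⟨integrable_fun_id_gaussianReal.mul_prod integrable_fun_id_gaussianReal, ?_⟩
  rw [stdGaussianPair, integral_prod_mul (fun x : ℝ => x) (fun x : ℝ => x)]
  simp

theorem integral_quadratic_form (a b c : ℝ) :
    Integrable (fun z : ℝ × ℝ => a * z.1 ^ 2 + b * z.2 ^ 2 + c * (z.1 * z.2)) stdGaussianPair ∧
    ∫ z, (a * z.1 ^ 2 + b * z.2 ^ 2 + c * (z.1 * z.2)) ∂stdGaussianPair = a + b := by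
  have h1 := hasIntegral_fst_sq.1.const_mul a
  have h2 := hasIntegral_snd_sq.1.const_mul b
  have h3 := hasIntegral_fst_mul_snd.1.const_mul c
  refine ⟨(h1.add h2).add h3, ?_⟩
  rw [integral_add (f := fun z : ℝ × ℝ => a * z.1 ^ 2 + b * z.2 ^ 2) (h1.add h2) h3,
    integral_add h1 h2, integral_const_mul, integral_const_mul,
    integral_const_mul, hasIntegral_fst_sq.2, hasIntegral_snd_sq.2, hasIntegral_fst_mul_snd.2]
  ring

/-- The witness is the image of the standard law under the lower triangular Cholesky factor `L` of
`S = L Lᵀ`. Its covariance is `S`, and `tr (S⁻¹ (Lw)(Lw)ᵀ) = |w|²` identifies the density. -/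
theorem exists_gaussianPair (s : Fin 3 → ℝ) (h0 : 0 < s 0) (hD : 0 < symDet s) :
    ∃ ν : Measure (ℝ × ℝ), IsProbabilityMeasure ν ∧ Integrable quadraticVector ν ∧
      ∫ z, quadraticVector z ∂ν = s ∧
      ν.withDensity (fun z => ENNReal.ofReal
        (Real.exp (-gaussianLogRatio s (quadraticVector z)))) = stdGaussianPair := by
  set a := √(s 0) with ha
  have ha0 : 0 < a := Real.sqrt_pos.2 h0
  have haa : a ^ 2 = s 0 := Real.sq_sqrt h0.le
  set k := √(symDet s / s 0) with hk
  have hk0 : 0 < k := Real.sqrt_pos.2 (by positivity)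
  have hkk : k ^ 2 = symDet s / s 0 := Real.sq_sqrt (by positivity)
  set b := s 2 / a with hb
  have hab : a * b = s 2 := by rw [hb]; field_simp
  have hbk : b ^ 2 + k ^ 2 = s 1 := by
    rw [hb, hkk, div_pow, haa, symDet]; field_simp; ring
  have hak : (a * k) ^ 2 = symDet s := by rw [mul_pow, haa, hkk]; field_simp
  set f : (ℝ × ℝ) →ₗ[ℝ] (ℝ × ℝ) :=
    Matrix.toLin (Module.Basis.finTwoProd ℝ) (Module.Basis.finTwoProd ℝ) !![a, 0; b, k] with hf
  have hfa : ∀ w, f w = (a * w.1, b * w.1 + k * w.2) := by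
    intro w; rw [hf, Matrix.toLin_finTwoProd_apply]; simp
  have hdet : LinearMap.det f = a * k := by
    rw [hf, LinearMap.det_toLin]; simp [Matrix.det_fin_two]
  have hfm : Measurable f := f.continuous_of_finiteDimensional.measurable
  have hq : ∀ w, quadraticVector (f w) = ![a ^ 2 * w.1 ^ 2,
      b ^ 2 * w.1 ^ 2 + k ^ 2 * w.2 ^ 2 + (2 * b * k) * (w.1 * w.2),
      a * b * w.1 ^ 2 + a * k * (w.1 * w.2)] := by
    intro w
    rw [hfa, quadraticVector]
    ext i; fin_cases i <;> simp <;> ring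
  have hI : ∀ i, Integrable (fun w => quadraticVector (f w) i) stdGaussianPair ∧
      ∫ w, quadraticVector (f w) i ∂stdGaussianPair = s i := by
    intro i
    simp only [hq]
    fin_cases i
    · have := integral_quadratic_form (a ^ 2) 0 0
      simpa [haa] using this
    · have := integral_quadratic_form (b ^ 2) (k ^ 2) (2 * b * k)
      simpa [hbk] using this
    · have := integral_quadratic_form (a * b) 0 (a * k)
      simpa [hab] using this
  have hint : Integrable (fun w => quadraticVector (f w)) stdGaussianPair :=
    Integrable.of_eval fun i => (hI i).1
  refine ⟨stdGaussianPair.map f, Measure.isProbabilityMeasure_map hfm.aemeasurable, ?_, ?_, ?_⟩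
  · rw [integrable_map_measure continuous_quadraticVector.aestronglyMeasurable hfm.aemeasurable]
    exact hint
  · rw [integral_map hfm.aemeasurable continuous_quadraticVector.aestronglyMeasurable]
    ext i
    rw [← (hI i).2, eval_integral (fun i => (hI i).1)]
  · rw [stdGaussianPair_eq_withDensity]
    refine map_withDensity_comp_linear (by rw [hdet]; positivity) (by fun_prop) (by fun_prop) ?_
    intro w
    rw [hdet, abs_of_pos (by positivity), ← ENNReal.ofReal_mul (by positivity),
      ← ENNReal.ofReal_mul (by positivity)]
    congr 1
    -- The Mahalanobis norm of `f w` is the Euclidean norm of `w`.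
    have htr : traceInvMul s (quadraticVector (f w)) = w.1 ^ 2 + w.2 ^ 2 := by
      rw [traceInvMul, div_eq_iff hD.ne', hq, ← hak, ← haa, ← hbk, ← hab]
      simp
      ring
    have hlog : Real.log (symDet s) = 2 * Real.log (a * k) := by
      rw [← hak, Real.log_pow]; norm_num
    rw [gaussianLogRatio, htr, hlog]
    have hak' : a * k = Real.exp (Real.log (a * k)) := (Real.exp_log (by positivity)).symm
    have hz : quadraticVector (f w) 0 = (f w).1 ^ 2 ∧ quadraticVector (f w) 1 = (f w).2 ^ 2 := by
      simp [quadraticVector]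
    rw [hz.1, hz.2]
    conv_rhs => rw [hak']
    rw [mul_left_comm, mul_left_comm _ (2 * Real.pi)⁻¹, ← Real.exp_add, ← Real.exp_add]
    congr 2
    ring

theorem gaussianLogRatio_empiricalQuadratic (s : Fin 3 → ℝ) (n : ℕ) (z : Fin n → ℝ × ℝ) :
    n * gaussianLogRatio s (empiricalQuadratic n z) =
      ∑ i, gaussianLogRatio s (quadraticVector (z i)) := by
  rcases n.eq_zero_or_pos with rfl | hn
  · simp
  have hn' : (n : ℝ) ≠ 0 := by positivity
  simp only [gaussianLogRatio, traceInvMul, empiricalQuadratic, Pi.smul_apply, Finset.sum_apply,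
    smul_eq_mul, ← Finset.sum_div, Finset.sum_sub_distrib, Finset.sum_add_distrib,
    ← Finset.mul_sum, ← Finset.sum_mul, Finset.sum_const, Finset.card_univ, Fintype.card_fin,
    nsmul_eq_mul]
  field_simp

/-- It suffices to test boxes, where the integrand is a product of functions of independent
coordinates. -/
theorem pi_withDensity_prod {ι α : Type*} [Fintype ι] [MeasurableSpace α] {μ : Measure α}
    [IsProbabilityMeasure μ] {g : α → ENNReal} (hg : Measurable g)
    [SigmaFinite (μ.withDensity g)] :
    (Measure.pi fun _ : ι => μ).withDensity (fun z => ∏ i, g (z i)) =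
      Measure.pi fun _ : ι => μ.withDensity g := by
  symm
  refine Measure.pi_eq fun t ht => ?_
  rw [withDensity_apply _ (MeasurableSet.univ_pi ht),
    ← lintegral_indicator (MeasurableSet.univ_pi ht)]
  have h1 : ∀ z : ι → α, (Set.univ.pi t).indicator (fun z => ∏ i, g (z i)) z =
      ∏ i, (t i).indicator g (z i) := by
    intro z
    by_cases hz : z ∈ Set.univ.pi t
    · rw [Set.indicator_of_mem hz]
      exact Finset.prod_congr rfl fun i _ => by rw [Set.indicator_of_mem (hz i trivial)]
    · rw [Set.indicator_of_notMem hz]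
      simp only [Set.mem_pi, Set.mem_univ, true_imp_iff, not_forall] at hz
      obtain ⟨i, hi⟩ := hz
      exact (Finset.prod_eq_zero (Finset.mem_univ i) (Set.indicator_of_notMem hi _)).symm
  rw [lintegral_congr h1]
  have hind := iIndepFun_pi (μ := fun _ : ι => μ) (X := fun i => (t i).indicator g)
    (fun i => (hg.indicator (ht i)).aemeasurable)
  rw [lintegral_prod_eq_prod_lintegral_of_indepFun Finset.univ _ hind
    (fun i => (hg.indicator (ht i)).comp (measurable_pi_apply i))]
  refine Finset.prod_congr rfl fun i _ => ?_
  rw [withDensity_apply _ (ht i), ← lintegral_indicator (ht i),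
    ← (measurePreserving_eval (fun _ : ι => μ) i).lintegral_comp (hg.indicator (ht i))]

theorem pi_stdGaussianPair_eq {s : Fin 3 → ℝ} {ν : Measure (ℝ × ℝ)} [IsProbabilityMeasure ν]
    (hν : ν.withDensity (fun z => ENNReal.ofReal
        (Real.exp (-gaussianLogRatio s (quadraticVector z)))) = stdGaussianPair) (n : ℕ) :
    (Measure.pi fun _ : Fin n => stdGaussianPair) = (Measure.pi fun _ : Fin n => ν).withDensity
      fun z => ENNReal.ofReal (Real.exp (-(n * gaussianLogRatio s (empiricalQuadratic n z)))) := by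
  have : IsProbabilityMeasure (ν.withDensity (fun z => ENNReal.ofReal
        (Real.exp (-gaussianLogRatio s (quadraticVector z))))) := by
    rw [hν]; infer_instance
  rw [← hν, ← pi_withDensity_prod (by fun_prop)]
  congr 1
  ext z
  rw [gaussianLogRatio_empiricalQuadratic, ← Finset.sum_neg_distrib, Real.exp_sum,
    ENNReal.ofReal_prod_of_nonneg fun _ _ => (Real.exp_pos _).le]

theorem pi_stdGaussianPair_le {s : Fin 3 → ℝ} (h0 : 0 < s 0) (hD : 0 < symDet s)
    {U : Set (Fin 3 → ℝ)} (hU : MeasurableSet U) {c : ℝ} (hc : ∀ y ∈ U, c ≤ gaussianLogRatio s y)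
    (n : ℕ) :
    (Measure.pi fun _ : Fin n => stdGaussianPair) (empiricalQuadratic n ⁻¹' U) ≤
      ENNReal.ofReal (Real.exp (-(n * c))) := by
  obtain ⟨ν, _, -, -, hν⟩ := exists_gaussianPair s h0 hD
  have hm := measurable_empiricalQuadratic n hU
  rw [pi_stdGaussianPair_eq hν, withDensity_apply _ hm]
  calc _ ≤ ∫⁻ _ in empiricalQuadratic n ⁻¹' U, ENNReal.ofReal (Real.exp (-(n * c)))
          ∂(Measure.pi fun _ : Fin n => ν) := by
        refine setLIntegral_mono measurable_const fun z hz => ?_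
        have := hc _ hz
        gcongr
    _ ≤ _ := by
        rw [setLIntegral_const]
        exact mul_le_of_le_one_right' prob_le_one

/-! ### Law of large numbers under the tilted law -/

theorem ae_tendsto_mean_comp {Ω α E : Type*} [MeasurableSpace Ω] [MeasurableSpace α]
    [NormedAddCommGroup E] [NormedSpace ℝ E] [CompleteSpace E] [MeasurableSpace E] [BorelSpace E]
    {μ : Measure Ω} {ν : Measure α} {X : ℕ → Ω → α} (hX : ∀ i, MeasurePreserving (X i) μ ν)
    (hind : iIndepFun X μ) {q : α → E} (hqm : Measurable q) (hq : Integrable q ν) :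
    ∀ᵐ ω ∂μ, Tendsto (fun n : ℕ => (n : ℝ)⁻¹ • (∑ i ∈ Finset.range n, q (X i ω))) atTop
      (𝓝 (∫ z, q z ∂ν)) := by
  have hident : ∀ i : ℕ, IdentDistrib (fun ω => q (X i ω)) (fun ω => q (X 0 ω)) μ μ := fun i =>
    (IdentDistrib.mk (hX i).measurable.aemeasurable (hX 0).measurable.aemeasurable
      ((hX i).map_eq.trans (hX 0).map_eq.symm)).comp hqm
  have h0 : ∫ ω, q (X 0 ω) ∂μ = ∫ z, q z ∂ν := by
    have hq' := hq.aestronglyMeasurable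
    rw [← (hX 0).map_eq] at hq' ⊢
    rw [integral_map (hX 0).measurable.aemeasurable hq']
  rw [← h0]
  exact strong_law_ae (fun i ω => q (X i ω)) ((hX 0).integrable_comp_of_integrable hq)
    (fun i j hij => (hind.indepFun hij).comp hqm hqm) hident

theorem ae_tendsto_mean_infinitePi {α E : Type*} [MeasurableSpace α]
    [NormedAddCommGroup E] [NormedSpace ℝ E] [CompleteSpace E] [MeasurableSpace E] [BorelSpace E]
    (ν : Measure α) [IsProbabilityMeasure ν] {q : α → E} (hqm : Measurable q)
    (hq : Integrable q ν) :
    ∀ᵐ ω ∂(Measure.infinitePi fun _ : ℕ => ν), Tendsto (fun n : ℕ =>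
      (n : ℝ)⁻¹ • (∑ i ∈ Finset.range n, q (ω i))) atTop (𝓝 (∫ z, q z ∂ν)) := by
  have hev : ∀ i : ℕ, MeasurePreserving (fun ω : ℕ → α => ω i)
      (Measure.infinitePi fun _ : ℕ => ν) ν := fun i =>
    measurePreserving_eval_infinitePi (fun _ : ℕ => ν) i
  have hind : iIndepFun (fun (i : ℕ) (ω : ℕ → α) => ω i) (Measure.infinitePi fun _ : ℕ => ν) :=
    iIndepFun_infinitePi (Ω := fun _ : ℕ => α) (𝓧 := fun _ : ℕ => α) (P := fun _ => ν)
      (X := fun _ x => x) fun _ => measurable_id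
  generalize Measure.infinitePi (fun _ : ℕ => ν) = μ at hev hind ⊢
  exact ae_tendsto_mean_comp hev hind hqm hq

/-- Puts all sample sizes on one probability space, as the strong law requires. -/
theorem pi_empiricalQuadratic_eq_infinitePi {ν : Measure (ℝ × ℝ)} [IsProbabilityMeasure ν]
    {U : Set (Fin 3 → ℝ)} (hU : MeasurableSet U) (n : ℕ) :
    (Measure.pi fun _ : Fin n => ν) (empiricalQuadratic n ⁻¹' U) =
      (Measure.infinitePi fun _ : ℕ => ν)
        {ω | (n : ℝ)⁻¹ • (∑ i ∈ Finset.range n, quadraticVector (ω i)) ∈ U} := by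
  rw [← Measure.infinitePi_eq_pi, ← Measure.map_infinitePi_infinitePi_of_inj
    (P := fun _ : ℕ => ν) (f := fun i : Fin n => (i : ℕ)) Fin.val_injective,
    Measure.map_apply (by fun_prop) (measurable_empiricalQuadratic n hU)]
  congr 1
  ext ω
  simp [empiricalQuadratic, Finset.sum_range]

theorem tendsto_pi_empiricalQuadratic {ν : Measure (ℝ × ℝ)} [IsProbabilityMeasure ν]
    (hint : Integrable quadraticVector ν) {U : Set (Fin 3 → ℝ)}
    (hU : IsOpen U) (hs : ∫ z, quadraticVector z ∂ν ∈ U) :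
    Tendsto (fun n => (Measure.pi fun _ : Fin n => ν) (empiricalQuadratic n ⁻¹' U)) atTop
      (𝓝 1) := by
  simp_rw [pi_empiricalQuadratic_eq_infinitePi hU.measurableSet]
  have hmeas : ∀ n : ℕ, MeasurableSet
      {ω : ℕ → ℝ × ℝ | (n : ℝ)⁻¹ • (∑ i ∈ Finset.range n, quadraticVector (ω i)) ∈ U} := by
    intro n
    have hq := continuous_quadraticVector.measurable
    have hm : Measurable fun ω : ℕ → ℝ × ℝ =>
        (n : ℝ)⁻¹ • (∑ i ∈ Finset.range n, quadraticVector (ω i)) := by fun_prop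
    exact hm hU.measurableSet
  have hlim := tendsto_measure_of_ae_tendsto_indicator_of_isFiniteMeasure
    (μ := Measure.infinitePi fun _ : ℕ => ν) atTop MeasurableSet.univ hmeas ?_
  · simpa using hlim
  · filter_upwards [ae_tendsto_mean_infinitePi ν
      continuous_quadraticVector.measurable hint] with ω hω
    filter_upwards [hω.eventually_mem (hU.mem_nhds hs)] with n hn
    simpa using hn

/-- Under the law with covariance `s` the event has probability tending to one, so eventually above
one half, and the density there is at least `exp (-n c)`. -/
theorem eventually_le_pi_stdGaussianPair {s : Fin 3 → ℝ} (h0 : 0 < s 0) (hD : 0 < symDet s)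
    {U : Set (Fin 3 → ℝ)} (hU : IsOpen U) (hs : s ∈ U) {c : ℝ}
    (hc : ∀ y ∈ U, gaussianLogRatio s y ≤ c) :
    ∀ᶠ n : ℕ in atTop, 2⁻¹ * ENNReal.ofReal (Real.exp (-(n * c))) ≤
      (Measure.pi fun _ : Fin n => stdGaussianPair) (empiricalQuadratic n ⁻¹' U) := by
  obtain ⟨ν, _, hint, hmean, hν⟩ := exists_gaussianPair s h0 hD
  have ht := tendsto_pi_empiricalQuadratic hint hU (by rwa [hmean])
  filter_upwards [ht.eventually (lt_mem_nhds (a := (2⁻¹ : ENNReal)) (by simp))] with n hn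
  rw [pi_stdGaussianPair_eq hν, withDensity_apply _
    (measurable_empiricalQuadratic n hU.measurableSet)]
  calc _ ≤ ∫⁻ _ in empiricalQuadratic n ⁻¹' U, ENNReal.ofReal (Real.exp (-(n * c)))
          ∂(Measure.pi fun _ : Fin n => ν) := by
        rw [setLIntegral_const, mul_comm]
        gcongr
    _ ≤ _ := by
        refine setLIntegral_mono (by fun_prop) fun z hz => ?_
        have := hc _ hz
        gcongr

/-! ### The rate function for independent standard pairs -/

@[fun_prop]
theorem continuous_symDet : Continuous symDet := by
  unfold symDet
  fun_prop

/-- Exponentiating removes the logarithm and turns the sublevel set into closed conditions: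
positivity of the exponential forces `symDet x > 0`, so weak inequalities on the diagonal suffice.
-/
theorem Pstar_zero_le_iff (x : Fin 3 → ℝ) (c : ℝ) :
    Pstar 0 x ≤ c ↔ 0 ≤ x 0 ∧ 0 ≤ x 1 ∧ Real.exp (x 0 + x 1 - 2 - 2 * c) ≤ symDet x := by
  unfold Pstar
  split_ifs with h
  · have hD : 0 < symDet x := by unfold symDet; linarith [h.2.2]
    have hlog : Real.log (√(1 - 0 ^ 2) / √(x 0 * x 1 - x 2 ^ 2)) = -(Real.log (symDet x) / 2) := by
      rw [← symDet]
      simp [Real.log_sqrt hD.le]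
    rw [EReal.coe_le_coe_iff, hlog, ← Real.le_log_iff_exp_le hD]
    constructor
    · intro h'
      exact ⟨h.1.le, h.2.1.le, by linarith⟩
    · rintro ⟨-, -, h'⟩
      linarith
  · refine iff_of_false (by simp) fun ⟨h0, h1, h2⟩ => h ?_
    have hD : x 2 ^ 2 < x 0 * x 1 := by
      have := (Real.exp_pos _).trans_le h2
      unfold symDet at this
      linarith
    have hpos : 0 < x 0 * x 1 := (sq_nonneg _).trans_lt hD
    exact ⟨h0.lt_of_ne' (left_ne_zero_of_mul hpos.ne'),
      h1.lt_of_ne' (right_ne_zero_of_mul hpos.ne'), hD⟩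

theorem isClosed_Pstar_zero_le (c : ℝ) : IsClosed {x | Pstar 0 x ≤ c} := by
  simp_rw [Pstar_zero_le_iff]
  have h0 : IsClosed {x : Fin 3 → ℝ | 0 ≤ x 0} := isClosed_le (by fun_prop) (by fun_prop)
  have h1 : IsClosed {x : Fin 3 → ℝ | 0 ≤ x 1} := isClosed_le (by fun_prop) (by fun_prop)
  have h2 : IsClosed {x : Fin 3 → ℝ | Real.exp (x 0 + x 1 - 2 - 2 * c) ≤ symDet x} :=
    isClosed_le (by fun_prop) (by fun_prop)
  exact h0.inter (h1.inter h2)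

theorem norm_le_of_symDet_nonneg {y : Fin 3 → ℝ} {R : ℝ} (h0 : 0 ≤ y 0) (h1 : 0 ≤ y 1)
    (hD : 0 ≤ symDet y) (hR : y 0 + y 1 ≤ R) : ‖y‖ ≤ R := by
  have h2 : |y 2| ≤ R := by
    refine abs_le_of_sq_le_sq ?_ (by linarith)
    unfold symDet at hD
    nlinarith
  refine (pi_norm_le_iff_of_nonneg (by linarith)).2 fun i => ?_
  rw [Real.norm_eq_abs]
  fin_cases i
  · exact (abs_of_nonneg h0).trans_le (by linarith)
  · exact (abs_of_nonneg h1).trans_le (by linarith)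
  · exact h2

/-- The inequality `u ≤ exp (u - 1)` on both diagonal entries bounds the determinant by `exp (x 0 +
x 1 - 2)`. -/
theorem Pstar_zero_nonneg (x : Fin 3 → ℝ) : 0 ≤ Pstar 0 x := by
  refine EReal.le_of_forall_lt_iff_le.1 fun c hc => ?_
  obtain ⟨h0, h1, h2⟩ := (Pstar_zero_le_iff x c).1 hc.le
  have h3 : symDet x ≤ x 0 * x 1 := by unfold symDet; nlinarith [sq_nonneg (x 2)]
  have h4 : x 0 * x 1 ≤ Real.exp (x 0 - 1) * Real.exp (x 1 - 1) :=
    mul_le_mul (by linarith [Real.add_one_le_exp (x 0 - 1)])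
      (by linarith [Real.add_one_le_exp (x 1 - 1)]) h1 (Real.exp_pos _).le
  rw [← Real.exp_add] at h4
  have h5 := Real.exp_le_exp.1 ((h2.trans h3).trans h4)
  exact_mod_cast (by linarith : (0 : ℝ) ≤ c)

theorem isGoodRateFunction_Pstar_zero : IsGoodRateFunction (Pstar 0) where
  nonneg := Pstar_zero_nonneg
  lowerSemicontinuous := by
    refine lowerSemicontinuous_iff_isClosed_preimage.2 fun a => ?_
    induction a with
    | bot =>
      convert! isClosed_empty
      ext x
      simpa using ne_of_gt (EReal.bot_lt_zero.trans_le (Pstar_zero_nonneg x))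
    | coe c => exact isClosed_Pstar_zero_le c
    | top => simp [Set.Iic_top]
  isCompact_sublevel c _ := by
    refine Metric.isCompact_of_isClosed_isBounded (isClosed_Pstar_zero_le c) ?_
    refine (Metric.isBounded_closedBall (x := (0 : Fin 3 → ℝ))
      (r := 4 * c + 4 * Real.log 2)).subset fun x hx => ?_
    obtain ⟨h0, h1, h2⟩ := (Pstar_zero_le_iff x c).1 hx
    rw [mem_closedBall_zero_iff]
    refine norm_le_of_symDet_nonneg h0 h1 ((Real.exp_pos _).le.trans h2) ?_
    have h3 : symDet x ≤ x 0 * x 1 := by unfold symDet; nlinarith [sq_nonneg (x 2)]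
    have h4 : x 0 * x 1 ≤ 4 * ((x 0 + x 1) / 4) ^ 2 := by nlinarith [sq_nonneg (x 0 - x 1)]
    -- Applying `u ≤ exp (u - 1)` at a quarter of the trace leaves only half the trace in the
    -- exponent, against the full trace in `h2`; the other half is thereby bounded.
    have h5 : 4 * ((x 0 + x 1) / 4) ^ 2 ≤
        Real.exp (2 * Real.log 2 + 2 * ((x 0 + x 1) / 4 - 1)) := by
      have h6 : (x 0 + x 1) / 4 ≤ Real.exp ((x 0 + x 1) / 4 - 1) := by
        linarith [Real.add_one_le_exp ((x 0 + x 1) / 4 - 1)]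
      have h7 : Real.exp (2 * Real.log 2 + 2 * ((x 0 + x 1) / 4 - 1)) =
          2 ^ 2 * Real.exp ((x 0 + x 1) / 4 - 1) ^ 2 := by
        rw [Real.exp_add, two_mul, two_mul, Real.exp_add, Real.exp_add, Real.exp_log two_pos]
        ring
      rw [h7]
      have := pow_le_pow_left₀ (by linarith) h6 2
      linarith
    have h8 := Real.exp_le_exp.1 (((h2.trans h3).trans h4).trans h5)
    linarith

theorem IsGoodRateFunction.comp_homeomorph {S S' : Type*} [TopologicalSpace S]
    [TopologicalSpace S'] {I : S → EReal} (h : IsGoodRateFunction I) (e : S ≃ₜ S') :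
    IsGoodRateFunction fun y => I (e.symm y) where
  nonneg _ := h.nonneg _
  lowerSemicontinuous := h.lowerSemicontinuous.comp e.symm.continuous
  isCompact_sublevel c hc := e.symm.isCompact_preimage.2 (h.isCompact_sublevel c hc)

/-! ### Local bounds for the empirical quadratic vector -/

theorem empiricalQuadratic_psd (n : ℕ) (z : Fin n → ℝ × ℝ) :
    0 ≤ empiricalQuadratic n z 0 ∧ 0 ≤ empiricalQuadratic n z 1 ∧
      0 ≤ symDet (empiricalQuadratic n z) := by
  have h0 : empiricalQuadratic n z 0 = (n : ℝ)⁻¹ * ∑ i, (z i).1 ^ 2 := by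
    simp [empiricalQuadratic, quadraticVector]
  have h1 : empiricalQuadratic n z 1 = (n : ℝ)⁻¹ * ∑ i, (z i).2 ^ 2 := by
    simp [empiricalQuadratic, quadraticVector]
  have h2 : empiricalQuadratic n z 2 = (n : ℝ)⁻¹ * ∑ i, (z i).1 * (z i).2 := by
    simp [empiricalQuadratic, quadraticVector]
  refine ⟨by rw [h0]; positivity, by rw [h1]; positivity, ?_⟩
  have hcs := Finset.sum_mul_sq_le_sq_mul_sq Finset.univ (fun i => (z i).1) (fun i => (z i).2)
  rw [symDet, h0, h1, h2]
  have : (0 : ℝ) ≤ ((n : ℝ)⁻¹) ^ 2 := by positivity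
  nlinarith

theorem exists_pi_trace_gt_le (c : ℝ) : ∃ R : ℝ, ∀ n : ℕ,
    (Measure.pi fun _ : Fin n => stdGaussianPair)
      (empiricalQuadratic n ⁻¹' {y | R < y 0 + y 1}) ≤ ENNReal.ofReal (Real.exp (-(n * c))) := by
  -- For covariance `2 · Id` the log ratio is `(y 0 + y 1) / 4 - log 4 / 2`, which exceeds `c`
  -- exactly beyond this threshold.
  refine ⟨4 * c + 2 * Real.log 4, fun n => ?_⟩
  have hD : symDet ![2, 2, 0] = 4 := by simp [symDet]; norm_num
  refine pi_stdGaussianPair_le (s := ![2, 2, 0]) (by simp) (by rw [hD]; norm_num)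
    (isOpen_lt (by fun_prop) (by fun_prop)).measurableSet (fun y hy => ?_) n
  have hy : 4 * c + 2 * Real.log 4 < y 0 + y 1 := hy
  rw [gaussianLogRatio, traceInvMul, hD]
  simp
  linarith

/-- Off the closed positive semidefinite cone a whole neighbourhood is never visited. On it, `x` may
be singular, so the tilt uses `S = X + ε Id`: then `tr (S⁻¹ X) ≤ 2`, and for small `ε` the
determinant is still small enough that the log ratio at `x` exceeds `c`. -/
theorem exists_nhds_gaussian_upper {x : Fin 3 → ℝ} {c : ℝ} (hc : (c : EReal) < Pstar 0 x) :
    ∃ U : Set (Fin 3 → ℝ), IsOpen U ∧ x ∈ U ∧ ∀ n : ℕ,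
      (Measure.pi fun _ : Fin n => stdGaussianPair) (empiricalQuadratic n ⁻¹' U) ≤
        ENNReal.ofReal (Real.exp (-(n * c))) := by
  by_cases hx : x 0 < 0 ∨ x 1 < 0 ∨ symDet x < 0
  · have hU0 : IsOpen {y : Fin 3 → ℝ | y 0 < 0} := isOpen_lt (by fun_prop) (by fun_prop)
    have hU1 : IsOpen {y : Fin 3 → ℝ | y 1 < 0} := isOpen_lt (by fun_prop) (by fun_prop)
    have hU2 : IsOpen {y : Fin 3 → ℝ | symDet y < 0} := isOpen_lt (by fun_prop) (by fun_prop)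
    refine ⟨{y | y 0 < 0 ∨ y 1 < 0 ∨ symDet y < 0},
      hU0.union (hU1.union hU2), hx, fun n => ?_⟩
    have : empiricalQuadratic n ⁻¹' {y | y 0 < 0 ∨ y 1 < 0 ∨ symDet y < 0} = ∅ := by
      refine Set.eq_empty_of_forall_notMem fun z hz => ?_
      obtain ⟨h0, h1, h2⟩ := empiricalQuadratic_psd n z
      rcases hz with h | h | h
      · exact h.not_ge h0
      · exact h.not_ge h1
      · exact h.not_ge h2
    rw [this, measure_empty]
    exact zero_le
  · push Not at hx
    obtain ⟨h0, h1, h2⟩ := hx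
    have h3 : symDet x < Real.exp (x 0 + x 1 - 2 - 2 * c) := by
      by_contra! h
      exact hc.not_ge ((Pstar_zero_le_iff x c).2 ⟨h0, h1, h⟩)
    have hcont : Continuous fun ε : ℝ => symDet ![x 0 + ε, x 1 + ε, x 2] := by
      simp only [symDet, Matrix.cons_val]
      fun_prop
    have hev : ∀ᶠ ε in 𝓝[>] (0 : ℝ),
        symDet ![x 0 + ε, x 1 + ε, x 2] < Real.exp (x 0 + x 1 - 2 - 2 * c) := by
      refine nhdsWithin_le_nhds (hcont.continuousAt.eventually_lt continuousAt_const ?_)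
      simpa [symDet] using h3
    obtain ⟨ε, hε, hε0⟩ := (hev.and self_mem_nhdsWithin).exists
    have hε0 : 0 < ε := hε0
    set s := ![x 0 + ε, x 1 + ε, x 2] with hs
    have hsD : symDet s = symDet x + ε * (x 0 + x 1) + ε ^ 2 := by
      simp [hs, symDet]; ring
    have hD : 0 < symDet s := by rw [hsD]; positivity
    refine ⟨{y | c < gaussianLogRatio s y}, isOpen_lt (by fun_prop) (by fun_prop), ?_,
      pi_stdGaussianPair_le (by simp [hs]; positivity) hD
        (isOpen_lt (by fun_prop) (by fun_prop)).measurableSet fun y hy => le_of_lt hy⟩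
    have hq : traceInvMul s x ≤ 2 := by
      rw [traceInvMul, div_le_iff₀ hD, hsD]
      simp [hs, symDet]
      nlinarith [mul_nonneg hε0.le h0, mul_nonneg hε0.le h1]
    have hlog : Real.log (symDet s) < x 0 + x 1 - 2 - 2 * c := (Real.log_lt_iff_lt_exp hD).2 hε
    rw [Set.mem_ofPred_eq, gaussianLogRatio]
    linarith

theorem eventually_gaussian_lower {x : Fin 3 → ℝ} {c : ℝ} (hc : Pstar 0 x < c)
    {U : Set (Fin 3 → ℝ)} (hU : IsOpen U) (hx : x ∈ U) : ∀ᶠ n : ℕ in atTop,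
      ENNReal.ofReal (Real.exp (-(n * c))) ≤
        (Measure.pi fun _ : Fin n => stdGaussianPair) (empiricalQuadratic n ⁻¹' U) := by
  obtain ⟨c', hc', hcc'⟩ := EReal.lt_iff_exists_real_btwn.1 hc
  -- Two gaps are needed: `c' < d` makes the log ratio strictly below `d` near `x`, and `d < c`
  -- absorbs the factor one half from the law of large numbers.
  obtain ⟨d, hd, hdc⟩ := exists_between (EReal.coe_lt_coe_iff.1 hcc')
  obtain ⟨h0, h1, h2⟩ := (Pstar_zero_le_iff x c').1 hc'.le
  have hD : 0 < symDet x := (Real.exp_pos _).trans_le h2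
  have h0' : 0 < x 0 := by
    refine h0.lt_of_ne' fun h => ?_
    rw [symDet, h] at hD
    nlinarith [sq_nonneg (x 2)]
  have hratio : gaussianLogRatio x x < d := by
    have hq : traceInvMul x x = 2 := by
      rw [traceInvMul, div_eq_iff hD.ne', symDet]; ring
    have := (Real.le_log_iff_exp_le hD).2 h2
    rw [gaussianLogRatio, hq]
    linarith
  have hV : IsOpen (U ∩ {y | gaussianLogRatio x y < d}) :=
    hU.inter (isOpen_lt (by fun_prop) (by fun_prop))
  filter_upwards [eventually_le_pi_stdGaussianPair h0' hD hV ⟨hx, hratio⟩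
    (fun y hy => le_of_lt hy.2), eventually_const_mul_exp_le (C := 2) (by simp) hdc] with n h3 h4
  refine le_trans ?_ (h3.trans (measure_mono (Set.preimage_mono Set.inter_subset_left)))
  rw [← ENNReal.div_eq_inv_mul, ENNReal.le_div_iff_mul_le (by simp) (by simp), mul_comm]
  exact h4

theorem localLDP_of_law_empiricalQuadratic {Ω : Type*} [MeasurableSpace Ω] {P : Measure Ω}
    {W : ℕ → Ω → Fin 3 → ℝ}
    (hW : ∀ n : ℕ, 0 < n → ∀ U : Set (Fin 3 → ℝ), MeasurableSet U → P {ω | W n ω ∈ U} =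
      (Measure.pi fun _ : Fin n => stdGaussianPair) (empiricalQuadratic n ⁻¹' U)) :
    LocalLDP P W (Pstar 0) where
  upper x c hc := by
    obtain ⟨U, hU, hxU, h⟩ := exists_nhds_gaussian_upper hc
    refine ⟨U, hU.mem_nhds hxU, ?_⟩
    filter_upwards [eventually_gt_atTop 0] with n hn
    rw [hW n hn U hU.measurableSet]
    exact h n
  lower x c hc U hU := by
    filter_upwards [eventually_gt_atTop 0,
      eventually_gaussian_lower hc isOpen_interior (mem_interior_iff_mem_nhds.2 hU)] with n hn h
    rw [← hW n hn _ isOpen_interior.measurableSet] at h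
    exact h.trans (measure_mono fun ω hω => interior_subset (s := U) hω)
  tight c := by
    obtain ⟨R, hR⟩ := exists_pi_trace_gt_le c
    refine ⟨Metric.closedBall 0 R, isCompact_closedBall 0 R, ?_⟩
    filter_upwards [eventually_gt_atTop 0] with n hn
    refine ((hW n hn _ Metric.isClosed_closedBall.measurableSet.compl).trans_le ?_).trans (hR n)
    refine measure_mono fun z hz => ?_
    by_contra h
    obtain ⟨h0, h1, h2⟩ := empiricalQuadratic_psd n z
    exact hz (mem_closedBall_zero_iff.2 (norm_le_of_symDet_nonneg h0 h1 h2 (not_lt.1 h)))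

/-! ### Volatilities and correlation as a linear change of variables -/

/-- The linear map on quadratic vectors induced by `(a, b) ↦ (σ₁ a, σ₂ (ρ a + r b))`. -/
noncomputable def correlationHomeomorph (σ₁ σ₂ ρ r : ℝ) (h₁ : σ₁ ≠ 0) (h₂ : σ₂ ≠ 0)
    (hr : r ≠ 0) : (Fin 3 → ℝ) ≃ₜ (Fin 3 → ℝ) where
  toFun x := ![σ₁ ^ 2 * x 0, σ₂ ^ 2 * (ρ ^ 2 * x 0 + 2 * ρ * r * x 2 + r ^ 2 * x 1),
    σ₁ * σ₂ * (ρ * x 0 + r * x 2)]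
  invFun y := ![y 0 / σ₁ ^ 2,
    (y 1 / σ₂ ^ 2 - 2 * ρ * (y 2 / (σ₁ * σ₂)) + ρ ^ 2 * (y 0 / σ₁ ^ 2)) / r ^ 2,
    (y 2 / (σ₁ * σ₂) - ρ * (y 0 / σ₁ ^ 2)) / r]
  left_inv x := by
    ext i; fin_cases i <;> simp <;> field_simp <;> ring
  right_inv y := by
    ext i; fin_cases i <;> simp <;> field_simp <;> ring
  continuous_toFun := by
    refine continuous_pi fun i => ?_
    fin_cases i <;> simp <;> fun_prop
  continuous_invFun := by
    refine continuous_pi fun i => ?_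
    fin_cases i <;> simp <;> fun_prop

/-- The map is a congruence by a matrix of determinant `r`: it multiplies the determinant by `r²`,
which cancels the `√(1 - ρ²)` in the logarithm, and it sends the linear term back to half the trace.
-/
theorem Pstar_correlated {ρ r : ℝ} (hr : 0 < r) (hρr : r ^ 2 = 1 - ρ ^ 2) (x : Fin 3 → ℝ) :
    Pstar ρ ![x 0, ρ ^ 2 * x 0 + 2 * ρ * r * x 2 + r ^ 2 * x 1, ρ * x 0 + r * x 2] =
      Pstar 0 x := by
  have hdet : x 0 * (ρ ^ 2 * x 0 + 2 * ρ * r * x 2 + r ^ 2 * x 1) - (ρ * x 0 + r * x 2) ^ 2 =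
      r ^ 2 * (x 0 * x 1 - x 2 ^ 2) := by ring
  have hiff : (0 < x 0 ∧ 0 < ρ ^ 2 * x 0 + 2 * ρ * r * x 2 + r ^ 2 * x 1 ∧
      (ρ * x 0 + r * x 2) ^ 2 < x 0 * (ρ ^ 2 * x 0 + 2 * ρ * r * x 2 + r ^ 2 * x 1)) ↔
      (0 < x 0 ∧ 0 < x 1 ∧ x 2 ^ 2 < x 0 * x 1) := by
    refine and_congr_right fun h0 => ?_
    have key : ∀ {a b d : ℝ}, 0 < a → (0 < b ∧ d ^ 2 < a * b ↔ 0 < a * b - d ^ 2) := by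
      intro a b d ha
      refine ⟨fun h => by linarith [h.2], fun h => ⟨?_, by linarith⟩⟩
      exact pos_of_mul_pos_right (by nlinarith [sq_nonneg d]) ha.le
    rw [key h0, key h0, hdet]
    exact mul_pos_iff_of_pos_left (by positivity)
  unfold Pstar
  simp only [Matrix.cons_val, hiff]
  split_ifs with h
  · have hD : 0 < x 0 * x 1 - x 2 ^ 2 := by linarith [h.2.2]
    have hlog : r / (r * √(x 0 * x 1 - x 2 ^ 2)) = 1 / √(x 0 * x 1 - x 2 ^ 2) := by
      field_simp
    have hfrac : (x 0 + (ρ ^ 2 * x 0 + 2 * ρ * r * x 2 + r ^ 2 * x 1) -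
        2 * ρ * (ρ * x 0 + r * x 2)) / (2 * r ^ 2) = (x 0 + x 1) / 2 := by
      rw [div_eq_div_iff (by positivity) two_ne_zero]
      linear_combination -(2 * x 0) * hρr
    rw [hdet, ← hρr, Real.sqrt_mul (by positivity), Real.sqrt_sq hr.le, hlog, hfrac]
    simp
  · rfl

theorem Pstar_scaled_eq {σ₁ σ₂ ρ r : ℝ} (h₁ : σ₁ ≠ 0) (h₂ : σ₂ ≠ 0) (hr : 0 < r)
    (hρr : r ^ 2 = 1 - ρ ^ 2) (y : Fin 3 → ℝ) :
    Pstar ρ ![y 0 / σ₁ ^ 2, y 1 / σ₂ ^ 2, y 2 / (σ₁ * σ₂)] =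
      Pstar 0 ((correlationHomeomorph σ₁ σ₂ ρ r h₁ h₂ hr.ne').symm y) := by
  set e := correlationHomeomorph σ₁ σ₂ ρ r h₁ h₂ hr.ne'
  obtain ⟨x, rfl⟩ := e.surjective y
  rw [e.symm_apply_apply, ← Pstar_correlated hr hρr]
  congr 1
  ext i
  fin_cases i <;> simp [e, correlationHomeomorph] <;> field_simp

/-! ### Brownian increments as independent Gaussian pairs -/

section Increments

variable {Ω : Type*} [MeasurableSpace Ω] {P : Measure Ω} {B B' : ℝ → Ω → ℝ}

theorem sum_Icc_one_floor_eq_sum_fin {E : Type*} [AddCommMonoid E] (n : ℕ) (f : ℕ → E) :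
    ∑ k ∈ Finset.Icc 1 ⌊(n : ℝ) * 1⌋₊, f k = ∑ i : Fin n, f (i + 1) := by
  rw [mul_one, Nat.floor_natCast, Fin.sum_univ_eq_sum_range (fun i => f (i + 1)),
    Finset.range_eq_Ico, Finset.sum_Ico_add' f 0 n 1]
  rfl

/-- The grid point `i / n` of the unit interval. -/
noncomputable def gridPoint (n : ℕ) (i : Fin (n + 1)) : Set.Icc (0 : ℝ) 1 :=
  ⟨(i : ℝ) / n, by positivity,
    div_le_one_of_le₀ (by exact_mod_cast Nat.lt_succ_iff.1 i.2) (by positivity)⟩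

theorem monotone_gridPoint (n : ℕ) : Monotone (gridPoint n) := fun i j hij => by
  have : (i : ℝ) ≤ (j : ℝ) := by exact_mod_cast hij
  exact div_le_div_of_nonneg_right this n.cast_nonneg

theorem increment_succ_eq {Ω : Type*} (n : ℕ) (i : Fin n) (Z : ℝ → Ω → ℝ) (ω : Ω) :
    increment n (i + 1) Z ω = Z (gridPoint n i.succ) ω - Z (gridPoint n i.castSucc) ω := by
  simp [increment, gridPoint]

/-- The normalized increments of a process over the grid of mesh `1 / n`. -/
noncomputable def normalizedIncrements (n : ℕ) (Z : ℝ → Ω → ℝ) (ω : Ω) (i : Fin n) : ℝ :=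
  √n * increment n (i + 1) Z ω

theorem IsBrownianUnit.hasLaw_normalizedIncrement (hB : IsBrownianUnit B P) {n : ℕ} (i : Fin n) :
    HasLaw (fun ω => normalizedIncrements n B ω i) (gaussianReal 0 1) P := by
  have hn : (0 : ℝ) < n := by exact_mod_cast i.pos
  have h := gaussianReal_const_mul (hB.gaussian_increments (gridPoint n i.castSucc)
    (gridPoint n i.succ) (gridPoint n i.castSucc).2.1
    (monotone_gridPoint n i.castSucc_lt_succ.le) (gridPoint n i.succ).2.2) (√n)
  have hv : NNReal.mk (√n ^ 2) (sq_nonneg _) * Real.toNNReal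
      ((gridPoint n i.succ : ℝ) - gridPoint n i.castSucc) = 1 := by
    ext
    have : (gridPoint n i.succ : ℝ) - gridPoint n i.castSucc = 1 / n := by
      simp [gridPoint]; field_simp; ring
    rw [this]
    simp [Real.sq_sqrt hn.le, hn.ne', Real.coe_toNNReal _ (inv_nonneg.2 hn.le)]
  rw [mul_zero, hv] at h
  simpa only [normalizedIncrements, increment_succ_eq] using h

theorem IsBrownianUnit.map_normalizedIncrements [IsProbabilityMeasure P]
    (hB : IsBrownianUnit B P) (n : ℕ) :
    P.map (normalizedIncrements n B) = Measure.pi fun _ : Fin n => gaussianReal 0 1 := by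
  have hind : iIndepFun (fun i ω => normalizedIncrements n B ω i) P := by
    have h := (hB.indep_increments n (gridPoint n) (monotone_gridPoint n)).comp
      (fun _ x => √n * x) (fun _ => by fun_prop)
    convert! h using 3 with i ω
    simp only [normalizedIncrements, increment_succ_eq, Function.comp]
  have h := (iIndepFun_iff_map_fun_eq_pi_map
    fun i => (hB.hasLaw_normalizedIncrement i).aemeasurable).1 hind
  simp_rw [fun i : Fin n => (hB.hasLaw_normalizedIncrement i).map_eq] at h
  exact h

theorem IsBrownianUnit.aemeasurable_normalizedIncrements (hB : IsBrownianUnit B P) (n : ℕ) :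
    AEMeasurable (normalizedIncrements n B) P :=
  aemeasurable_pi_lambda _ fun i => (hB.hasLaw_normalizedIncrement i).aemeasurable

theorem IndepProcessesUnit.indepFun_normalizedIncrements (h : IndepProcessesUnit B B' P) (n : ℕ) :
    IndepFun (normalizedIncrements n B) (normalizedIncrements n B') P := by
  have hm : Measurable fun (p : Set.Icc (0 : ℝ) 1 → ℝ) (i : Fin n) =>
      √n * (p (gridPoint n i.succ) - p (gridPoint n i.castSucc)) := by fun_prop
  convert! IndepFun.comp h hm hm using 1 <;>
  · ext ω i
    simp only [normalizedIncrements, increment_succ_eq, Function.comp]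

theorem map_pair_normalizedIncrements [IsProbabilityMeasure P] (hB : IsBrownianUnit B P)
    (hB' : IsBrownianUnit B' P) (h : IndepProcessesUnit B B' P) (n : ℕ) :
    P.map (fun ω i => (normalizedIncrements n B ω i, normalizedIncrements n B' ω i)) =
      Measure.pi fun _ : Fin n => stdGaussianPair := by
  have hm := hB.aemeasurable_normalizedIncrements n
  have hm' := hB'.aemeasurable_normalizedIncrements n
  have h1 := (indepFun_iff_map_prod_eq_prod_map_map hm hm').1
    (h.indepFun_normalizedIncrements n)
  rw [hB.map_normalizedIncrements, hB'.map_normalizedIncrements] at h1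
  -- Regroups a pair of independent vectors as a vector of independent pairs.
  have h2 := (measurePreserving_arrowProdEquivProdArrow ℝ ℝ (Fin n)
    (fun _ => gaussianReal 0 1) (fun _ => gaussianReal 0 1)).symm.map_eq
  rw [← h1, AEMeasurable.map_map_of_aemeasurable
    (MeasurableEquiv.measurable _).aemeasurable (hm.prodMk hm')] at h2
  exact h2

theorem realizedVector_eq_empiricalQuadratic {Ω : Type*} {B B' : ℝ → Ω → ℝ} {n : ℕ} (hn : 0 < n) (ω : Ω) :
    realizedVector n 1 B B' ω = empiricalQuadratic n
      fun i => (normalizedIncrements n B ω i, normalizedIncrements n B' ω i) := by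
  have hn' : (0 : ℝ) < n := by exact_mod_cast hn
  have hs : √(n : ℝ) ^ 2 = n := Real.sq_sqrt hn'.le
  have h : ∀ f : Fin n → ℝ, ∑ i, f i = (n : ℝ)⁻¹ * ∑ i, √(n : ℝ) ^ 2 * f i := fun f => by
    rw [← Finset.mul_sum, hs, inv_mul_cancel_left₀ hn'.ne']
  ext j
  fin_cases j <;>
  simp [realizedVector, realizedVolatility, realizedCovariance, sum_Icc_one_floor_eq_sum_fin,
    empiricalQuadratic, quadraticVector, normalizedIncrements, -mul_one] <;>
  rw [h] <;> congr 1 <;> refine Finset.sum_congr rfl fun i _ => ?_ <;> ring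

theorem measure_realizedVector_mem [IsProbabilityMeasure P] (hB : IsBrownianUnit B P)
    (hB' : IsBrownianUnit B' P) (h : IndepProcessesUnit B B' P) (n : ℕ) (hn : 0 < n)
    (U : Set (Fin 3 → ℝ)) (hU : MeasurableSet U) :
    P {ω | realizedVector n 1 B B' ω ∈ U} =
      (Measure.pi fun _ : Fin n => stdGaussianPair) (empiricalQuadratic n ⁻¹' U) := by
  have hm : AEMeasurable (fun ω (i : Fin n) =>
      (normalizedIncrements n B ω i, normalizedIncrements n B' ω i)) P :=
    aemeasurable_pi_lambda _ fun i =>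
      (hB.hasLaw_normalizedIncrement i).aemeasurable.prodMk
        (hB'.hasLaw_normalizedIncrement i).aemeasurable
  rw [← map_pair_normalizedIncrements hB hB' h n,
    Measure.map_apply_of_aemeasurable hm (measurable_empiricalQuadratic n hU)]
  simp_rw [realizedVector_eq_empiricalQuadratic hn]
  rfl

end Increments

/-! ### The effect of a bounded drift -/

section Drift

variable {Ω : Type*} [MeasurableSpace Ω] {P : Measure Ω}

/-- Fubini makes almost every path of `b` essentially bounded by the global essential supremum `m`,
so one null set serves all `s` and `t`. -/
theorem BoundedDrift.exists_integral_increment_le [SFinite P] {b : ℝ → Ω → ℝ}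
    (hb : BoundedDrift b P) : ∃ m : ℝ, 0 ≤ m ∧ ∀ᵐ ω ∂P, ∀ s t : ℝ, 0 ≤ s → s ≤ t → t ≤ 1 →
      |(∫ u in (0 : ℝ)..t, b u ω) - ∫ u in (0 : ℝ)..s, b u ω| ≤ m * (t - s) := by
  set m := (eLpNorm (Function.uncurry b) ⊤ ((volume.restrict (Set.Icc (0 : ℝ) 1)).prod P)).toReal
  refine ⟨m, ENNReal.toReal_nonneg, ?_⟩
  have hbound : ∀ᵐ z ∂((volume.restrict (Set.Icc (0 : ℝ) 1)).prod P), |b z.1 z.2| ≤ m := by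
    have h := ae_le_eLpNormEssSup (f := Function.uncurry b)
      (μ := (volume.restrict (Set.Icc (0 : ℝ) 1)).prod P)
    filter_upwards [h] with z hz
    rw [← eLpNorm_exponent_top] at hz
    have := ENNReal.toReal_mono hb.eLpNorm_ne_top hz
    rwa [toReal_enorm, Real.norm_eq_abs] at this
  have hbound' : ∀ᵐ ω ∂P, ∀ᵐ u ∂(volume.restrict (Set.Icc (0 : ℝ) 1)), |b u ω| ≤ m :=
    Measure.ae_ae_of_ae_prod (Measure.measurePreserving_swap.quasiMeasurePreserving.ae hbound)
  have hmeas : ∀ᵐ ω ∂P, AEStronglyMeasurable (fun u => b u ω)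
      (volume.restrict (Set.Icc (0 : ℝ) 1)) :=
    AEStronglyMeasurable.prodMk_left (f := fun z : Ω × ℝ => b z.2 z.1)
      hb.aestronglyMeasurable.prod_swap
  filter_upwards [hbound', hmeas] with ω h1 h2 s t hs hst ht
  have hint : IntegrableOn (fun u => b u ω) (Set.Icc (0 : ℝ) 1) :=
    Integrable.of_bound h2 m h1
  have hi : ∀ x y : ℝ, 0 ≤ x → x ≤ y → y ≤ 1 →
      IntervalIntegrable (fun u => b u ω) volume x y := fun x y hx hxy hy =>
    (intervalIntegrable_iff_integrableOn_Icc_of_le hxy).2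
      (hint.mono_set (Set.Icc_subset_Icc hx hy))
  rw [intervalIntegral.integral_interval_sub_left (hi 0 t le_rfl (hs.trans hst) ht)
    (hi 0 s le_rfl hs (hst.trans ht)), ← abs_of_nonneg (sub_nonneg.2 hst), ← Real.norm_eq_abs]
  refine intervalIntegral.norm_integral_le_of_norm_le_const_ae ?_
  filter_upwards [(ae_restrict_iff' measurableSet_Icc).1 h1] with u hu hut
  rw [Set.uIoc_of_le hst] at hut
  exact hu ⟨hs.trans hut.1.le, hut.2.trans ht⟩

theorem SolvesIto.exists_increment_sub_le [SFinite P] {σ : ℝ} {B b X : ℝ → Ω → ℝ}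
    (hX : SolvesIto σ B b X P) (hb : BoundedDrift b P) : ∃ m : ℝ, 0 ≤ m ∧ ∀ᵐ ω ∂P,
      ∀ (n : ℕ) (i : Fin n), |increment n (i + 1) X ω - σ * increment n (i + 1) B ω| ≤ m / n := by
  obtain ⟨m, hm, h⟩ := hb.exists_integral_increment_le
  refine ⟨m, hm, ?_⟩
  filter_upwards [h, hX] with ω h1 h2 n i
  have h3 := h1 _ _ (gridPoint n i.castSucc).2.1 (monotone_gridPoint n i.castSucc_lt_succ.le)
    (gridPoint n i.succ).2.2
  rw [increment_succ_eq, increment_succ_eq, h2 _ (gridPoint n i.succ).2,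
    h2 _ (gridPoint n i.castSucc).2]
  have h4 : (gridPoint n i.succ : ℝ) - gridPoint n i.castSucc = 1 / n := by
    simp [gridPoint, ← sub_div]
  rw [h4, mul_one_div] at h3
  convert h3 using 2
  ring

/-- The cross terms are of size `m / n` times sums of `|a i|` and `|b i|`, which are of order `√n`
when the sums of squares are bounded; the remaining products contribute at most `m² / n`. -/
theorem abs_sum_mul_sub_sum_mul_le {n : ℕ} (hn : 0 < n) {m C : ℝ} (hm : 0 ≤ m) (hC : 0 ≤ C)
    {a b x x' y y' : Fin n → ℝ} (hx : ∀ i, |x i| ≤ C * (|a i| + |b i|))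
    (hx' : ∀ i, |x' i| ≤ C * (|a i| + |b i|)) (hy : ∀ i, |y i - x i| ≤ m / n)
    (hy' : ∀ i, |y' i - x' i| ≤ m / n) :
    |∑ i, x i * x' i - ∑ i, y i * y' i| ≤
      (m * C + m ^ 2) * (∑ i, a i ^ 2 + ∑ i, b i ^ 2 + 2) / √n := by
  have hn' : (0 : ℝ) < n := by exact_mod_cast hn
  set r := √(n : ℝ) with hr
  have hr0 : 0 < r := Real.sqrt_pos.2 hn'
  have hrr : r ^ 2 = n := Real.sq_sqrt hn'.le
  have hr1 : 1 ≤ r := by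
    rw [hr, Real.one_le_sqrt]; exact_mod_cast hn
  -- Young's inequality with weight `√n` balances the two parts; summing the `1 / r` terms for `a`
  -- and `b` over `n` indices produces the `+ 2`.
  have habs : ∀ t : ℝ, |t| ≤ (r * t ^ 2 + 1 / r) / 2 := by
    intro t
    have h1 : 0 ≤ (r * |t| - 1) ^ 2 / r := by positivity
    have h2 : (r * |t| - 1) ^ 2 / r = r * t ^ 2 + 1 / r - 2 * |t| := by
      rw [← sq_abs t]; field_simp; ring
    linarith
  have hterm : ∀ i, |x i * x' i - y i * y' i| ≤
      m * C / r * (a i ^ 2 + b i ^ 2) + (2 * (m * C) / (r * n) + m ^ 2 / n ^ 2) := by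
    intro i
    have h1 : x i * x' i - y i * y' i =
        -(x i * (y' i - x' i) + x' i * (y i - x i) + (y i - x i) * (y' i - x' i)) := by ring
    have h2 : |x i * (y' i - x' i)| ≤ C * (|a i| + |b i|) * (m / n) := by
      rw [abs_mul]; exact mul_le_mul (hx i) (hy' i) (abs_nonneg _) (by positivity)
    have h3 : |x' i * (y i - x i)| ≤ C * (|a i| + |b i|) * (m / n) := by
      rw [abs_mul]; exact mul_le_mul (hx' i) (hy i) (abs_nonneg _) (by positivity)
    have h4 : |(y i - x i) * (y' i - x' i)| ≤ m / n * (m / n) := by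
      rw [abs_mul]; exact mul_le_mul (hy i) (hy' i) (abs_nonneg _) (by positivity)
    have h5 : C * (|a i| + |b i|) * (m / n) ≤
        C * ((r * a i ^ 2 + 1 / r) / 2 + (r * b i ^ 2 + 1 / r) / 2) * (m / n) := by
      gcongr
      · exact habs _
      · exact habs _
    rw [h1, abs_neg]
    calc _ ≤ _ := abs_add_three _ _ _
      _ ≤ 2 * (C * ((r * a i ^ 2 + 1 / r) / 2 + (r * b i ^ 2 + 1 / r) / 2) * (m / n))
          + m / n * (m / n) := by linarith
      _ = _ := by rw [← hrr]; field_simp; ring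
  rw [← Finset.sum_sub_distrib]
  calc _ ≤ ∑ i, |x i * x' i - y i * y' i| := Finset.abs_sum_le_sum_abs _ _
    _ ≤ ∑ i, (m * C / r * (a i ^ 2 + b i ^ 2) + (2 * (m * C) / (r * n) + m ^ 2 / n ^ 2)) :=
      Finset.sum_le_sum fun i _ => hterm i
    _ = m * C * (∑ i, a i ^ 2 + ∑ i, b i ^ 2 + 2) / r + m ^ 2 / n := by
      rw [Finset.sum_add_distrib, ← Finset.mul_sum, Finset.sum_add_distrib]
      simp only [Finset.sum_const, Finset.card_univ, Fintype.card_fin, nsmul_eq_mul]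
      field_simp
      ring
    _ ≤ m * C * (∑ i, a i ^ 2 + ∑ i, b i ^ 2 + 2) / r +
        m ^ 2 * (∑ i, a i ^ 2 + ∑ i, b i ^ 2 + 2) / r := by
      have h1 : 0 ≤ ∑ i, a i ^ 2 := Finset.sum_nonneg fun i _ => sq_nonneg _
      have h2 : 0 ≤ ∑ i, b i ^ 2 := Finset.sum_nonneg fun i _ => sq_nonneg _
      gcongr
      · nlinarith [sq_nonneg m]
      · nlinarith
    _ = _ := by ring

end Drift

/-! ### Realized vectors of the drifted processes and conclusion -/

theorem aemeasurable_increment {Ω : Type*} [MeasurableSpace Ω] {P : Measure Ω}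
    {X : ℝ → Ω → ℝ} (hX : ∀ t ∈ Set.Icc (0 : ℝ) 1, AEMeasurable (X t) P) {n : ℕ} (i : Fin n) :
    AEMeasurable (increment n (i + 1) X) P := by
  refine ((hX _ (gridPoint n i.succ).2).sub (hX _ (gridPoint n i.castSucc).2)).congr ?_
  exact ae_of_all _ fun ω => (increment_succ_eq n i X ω).symm

theorem aemeasurable_realizedVector {Ω : Type*} [MeasurableSpace Ω] {P : Measure Ω}
    {X Y : ℝ → Ω → ℝ} (hX : ∀ t ∈ Set.Icc (0 : ℝ) 1, AEMeasurable (X t) P)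
    (hY : ∀ t ∈ Set.Icc (0 : ℝ) 1, AEMeasurable (Y t) P) (n : ℕ) :
    AEMeasurable (realizedVector n 1 X Y) P := by
  have h1 := fun i : Fin n => aemeasurable_increment hX i
  have h2 := fun i : Fin n => aemeasurable_increment hY i
  refine aemeasurable_pi_iff.2 fun j => ?_
  fin_cases j <;>
  simp only [realizedVector, realizedVolatility, realizedCovariance, sum_Icc_one_floor_eq_sum_fin,
    Fin.zero_eta, Fin.mk_one, Fin.reduceFinMk, Matrix.cons_val]
  · exact Finset.aemeasurable_fun_sum _ fun i _ => (h1 i).pow_const 2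
  · exact Finset.aemeasurable_fun_sum _ fun i _ => (h2 i).pow_const 2
  · exact Finset.aemeasurable_fun_sum _ fun i _ => (h1 i).mul (h2 i)

theorem realizedVector_eq_sum_fin {Ω : Type*} (n : ℕ) (X Y : ℝ → Ω → ℝ) (ω : Ω) :
    realizedVector n 1 X Y ω =
      ![∑ i : Fin n, increment n (i + 1) X ω * increment n (i + 1) X ω,
        ∑ i : Fin n, increment n (i + 1) Y ω * increment n (i + 1) Y ω,
        ∑ i : Fin n, increment n (i + 1) X ω * increment n (i + 1) Y ω] := by
  simp only [realizedVector, realizedVolatility, realizedCovariance, sum_Icc_one_floor_eq_sum_fin,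
    pow_two]

theorem correlationHomeomorph_realizedVector {Ω : Type*} {σ₁ σ₂ ρ r : ℝ} (h₁ : σ₁ ≠ 0)
    (h₂ : σ₂ ≠ 0) (hr : r ≠ 0) (n : ℕ) (B B' : ℝ → Ω → ℝ) (ω : Ω) :
    correlationHomeomorph σ₁ σ₂ ρ r h₁ h₂ hr (realizedVector n 1 B B' ω) =
      realizedVector n 1 (fun t ω => σ₁ * B t ω) (fun t ω => σ₂ * (ρ * B t ω + r * B' t ω)) ω := by
  ext j
  fin_cases j <;>
  simp only [correlationHomeomorph, Homeomorph.homeomorph_mk_coe, Equiv.coe_fn_mk,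
    realizedVector_eq_sum_fin, Fin.zero_eta, Fin.mk_one, Fin.reduceFinMk, Matrix.cons_val,
    Finset.mul_sum, ← Finset.sum_add_distrib, increment] <;>
  refine Finset.sum_congr rfl fun i _ => ?_ <;> ring

theorem dist_realizedVector_le {Ω : Type*} {n : ℕ} (hn : 0 < n) {m C : ℝ} (hm : 0 ≤ m)
    (hC : 0 ≤ C) {A B X X' Y Y' : ℝ → Ω → ℝ} {ω : Ω}
    (hX : ∀ i : Fin n, |increment n (i + 1) X ω| ≤
      C * (|increment n (i + 1) A ω| + |increment n (i + 1) B ω|))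
    (hX' : ∀ i : Fin n, |increment n (i + 1) X' ω| ≤
      C * (|increment n (i + 1) A ω| + |increment n (i + 1) B ω|))
    (hY : ∀ i : Fin n, |increment n (i + 1) Y ω - increment n (i + 1) X ω| ≤ m / n)
    (hY' : ∀ i : Fin n, |increment n (i + 1) Y' ω - increment n (i + 1) X' ω| ≤ m / n) :
    dist (realizedVector n 1 X X' ω) (realizedVector n 1 Y Y' ω) ≤
      (m * C + m ^ 2) * (realizedVector n 1 A B ω 0 + realizedVector n 1 A B ω 1 + 2) / √n := by
  simp only [realizedVector_eq_sum_fin, Matrix.cons_val, ← pow_two]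
  have h0 := abs_sum_mul_sub_sum_mul_le hn hm hC hX hX hY hY
  refine (dist_pi_le_iff ((abs_nonneg _).trans h0)).2 fun j => ?_
  rw [Real.dist_eq]
  fin_cases j <;> simp only [Fin.zero_eta, Fin.mk_one, Fin.reduceFinMk, Matrix.cons_val, pow_two]
  · simpa only [pow_two] using h0
  · simpa only [pow_two] using abs_sum_mul_sub_sum_mul_le hn hm hC hX' hX' hY' hY'
  · simpa only [pow_two] using abs_sum_mul_sub_sum_mul_le hn hm hC hX hX' hY hY'

theorem mainTheorem2 {Ω : Type*} [MeasurableSpace Ω] (P : Measure Ω) [IsProbabilityMeasure P]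
    (σ₁ σ₂ ρ : ℝ) (hσ₁ : 0 < σ₁) (hσ₂ : 0 < σ₂) (hρ : ρ ∈ Set.Ioo (-1 : ℝ) 1)
    (B₁ B₃ b₁ b₂ X₁ X₂ : ℝ → Ω → ℝ)
    (hB₁ : IsBrownianUnit B₁ P) (hB₃ : IsBrownianUnit B₃ P) (hB : IndepProcessesUnit B₁ B₃ P)
    (hb₁ : BoundedDrift b₁ P) (hb₂ : BoundedDrift b₂ P)
    (hX₁m : ∀ t ∈ Set.Icc (0 : ℝ) 1, AEMeasurable (X₁ t) P)
    (hX₂m : ∀ t ∈ Set.Icc (0 : ℝ) 1, AEMeasurable (X₂ t) P)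
    (hX₁ : SolvesIto σ₁ B₁ b₁ X₁ P)
    (hX₂ : SolvesIto σ₂ (correlatedProcess ρ B₁ B₃) b₂ X₂ P) :
    SatisfiesGoodLDP P (fun n => realizedVector n 1 X₁ X₂) (fun n => (n : ℝ))
      (fun x => Pstar ρ ![x 0 / σ₁ ^ 2, x 1 / σ₂ ^ 2, x 2 / (σ₁ * σ₂)]) := by
  have hρ2 : 0 < 1 - ρ ^ 2 := by nlinarith [hρ.1, hρ.2]
  set r := √(1 - ρ ^ 2) with hr
  have hr0 : 0 < r := Real.sqrt_pos.2 hρ2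
  have hrr : r ^ 2 = 1 - ρ ^ 2 := Real.sq_sqrt hρ2.le
  have hr1 : r ≤ 1 := by nlinarith [sq_nonneg ρ]
  have hρ1 : |ρ| ≤ 1 := abs_le.2 ⟨hρ.1.le, hρ.2.le⟩
  simp_rw [Pstar_scaled_eq hσ₁.ne' hσ₂.ne' hr0 hrr]
  have hlaw := measure_realizedVector_mem hB₁ hB₃ hB
  have hG := (localLDP_of_law_empiricalQuadratic hlaw).comp_homeomorph
    (correlationHomeomorph σ₁ σ₂ ρ r hσ₁.ne' hσ₂.ne' hr0.ne')
  refine (hG.of_exponentially_close fun δ hδ c => ?_).satisfiesGoodLDP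
    (isGoodRateFunction_Pstar_zero.comp_homeomorph _)
    (fun n => aemeasurable_realizedVector hX₁m hX₂m n)
  obtain ⟨m₁, hm₁, h₁⟩ := hX₁.exists_increment_sub_le hb₁
  obtain ⟨m₂, hm₂, h₂⟩ := hX₂.exists_increment_sub_le hb₂
  -- `R` is fixed by the target rate `c` alone. When the Brownian trace is at most `R`, the drift
  -- error is at most `D * (R + 2) / √n`, so a distance of `δ` or more forces the trace above `R`
  -- for large `n`, almost surely.
  obtain ⟨R, hR⟩ := exists_pi_trace_gt_le c
  set D := (m₁ + m₂) * (σ₁ + σ₂) + (m₁ + m₂) ^ 2 with hD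
  have hD0 : 0 ≤ D := by positivity
  have hlim : Tendsto (fun n : ℕ => D * (R + 2) / √(n : ℝ)) atTop (𝓝 0) :=
    (Real.tendsto_sqrt_atTop.comp tendsto_natCast_atTop_atTop).const_div_atTop _
  filter_upwards [eventually_gt_atTop 0, hlim.eventually (gt_mem_nhds hδ)] with n hn hnδ
  refine le_trans ?_ ((hlaw n hn _
    (isOpen_lt (f := fun _ => R) (g := fun y : Fin 3 → ℝ => y 0 + y 1)
      (by fun_prop) (by fun_prop)).measurableSet).trans_le (hR n))
  refine measure_mono_ae ?_
  filter_upwards [h₁, h₂] with ω hω₁ hω₂ hω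
  by_contra hle
  have hle : realizedVector n 1 B₁ B₃ ω 0 + realizedVector n 1 B₁ B₃ ω 1 ≤ R := not_lt.1 hle
  have hω : δ ≤ dist _ _ := hω
  rw [correlationHomeomorph_realizedVector] at hω
  have hinc₁ : ∀ i : Fin n, increment n (i + 1) (fun t ω => σ₁ * B₁ t ω) ω =
      σ₁ * increment n (i + 1) B₁ ω := fun i => by simp only [increment]; ring
  have hinc₂ : ∀ i : Fin n, increment n (i + 1) (fun t ω => σ₂ * (ρ * B₁ t ω + r * B₃ t ω)) ω =
      σ₂ * increment n (i + 1) (correlatedProcess ρ B₁ B₃) ω := fun i => by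
    simp only [increment, correlatedProcess]; ring
  have hinc₃ : ∀ i : Fin n, increment n (i + 1) (correlatedProcess ρ B₁ B₃) ω =
      ρ * increment n (i + 1) B₁ ω + r * increment n (i + 1) B₃ ω := fun i => by
    simp only [increment, correlatedProcess]; ring
  -- The sums `m₁ + m₂` and `σ₁ + σ₂` are common constants for both coordinates; the second one uses
  -- `|ρ| ≤ 1` and `r ≤ 1`.
  have hdist := dist_realizedVector_le (A := B₁) (B := B₃) (Y := X₁) (Y' := X₂)
    (X := fun t ω => σ₁ * B₁ t ω) (X' := fun t ω => σ₂ * (ρ * B₁ t ω + r * B₃ t ω)) (ω := ω) hn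
    (m := m₁ + m₂) (C := σ₁ + σ₂) (by positivity) (by positivity)
    (fun i => by
      rw [hinc₁, abs_mul, abs_of_pos hσ₁]
      exact mul_le_mul (by linarith) (le_add_of_nonneg_right (abs_nonneg _)) (abs_nonneg _)
        (by positivity))
    (fun i => by
      rw [hinc₂, hinc₃, abs_mul, abs_of_pos hσ₂]
      refine mul_le_mul (by linarith) ((abs_add_le _ _).trans (add_le_add ?_ ?_)) (abs_nonneg _)
        (by positivity)
      · rw [abs_mul]
        exact mul_le_of_le_one_left (abs_nonneg _) hρ1
      · rw [abs_mul, abs_of_pos hr0]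
        exact mul_le_of_le_one_left (abs_nonneg _) hr1)
    (fun i => by
      rw [hinc₁]
      exact (hω₁ n i).trans (div_le_div_of_nonneg_right (by linarith) n.cast_nonneg))
    (fun i => by
      rw [hinc₂]
      exact (hω₂ n i).trans (div_le_div_of_nonneg_right (by linarith) n.cast_nonneg))
  have hmono : D * (realizedVector n 1 B₁ B₃ ω 0 + realizedVector n 1 B₁ B₃ ω 1 + 2) / √n ≤
      D * (R + 2) / √n := by gcongr
  linarith
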